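/- Definitions. Let $N\ge 2$ be an integer and let $B,L\subset\mathbb Z$ be finite sets with $\#B=\#L\ge 2$. The triple $(N,B,L)$ is a Hadamard triple if the matrix $\big((\#B)^{-1/2}e^{2\pi i b\ell/N}\big)_{b\in B,\,\ell\in L}$ is unitary. Let $K(N,L)=\{\sum_{k\ge1}\ell_kN^{-k}:\ell_k\in L\}$ be the self-similar set of the maps $\tau_\ell(x)=(x+\ell)/N$, $\ell\in L$, and let $\mu_{N,B}$ be the self-similar measure, i.e. the unique Borel probability measure on $\mathbb R$ with $\mu=\frac1{\#B}\sum_{b\in B}\mu\circ\tau_b^{-1}$, where $\tau_b(x)=(x+b)/N$. Put $m_B(x)=\frac1{\#B}\sum_{b\in B}e^{2\pi i b x}$. A finite set $C=\{x_1,\dots,x_k\}$ is an $m_B$-cycle if there are $\ell_1,\dots,\ell_k\in L$ with $\tau_{\ell_j}(x_j)=x_{j+1}$ for $1\le j<k$ and $\tau_{\ell_k}(x_k)=x_1$, and $|m_B(x_j)|=1$ for all $j$. When $0\in B\cap L$, let $\Lambda$ be the smallest subset of $\mathbb R$ that contains $-C$ for every $m_B$-cycle $C$ and satisfies $N\Lambda+L\subset\Lambda$;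 $(\mu_{N,B},\Lambda)$ is the canonical spectral pair generated by $(N,B,L)$. A pair $(\mu,\Lambda)$ of a Borel probability measure on $\mathbb R$ and a countable set $\Lambda\subset\mathbb R$ is a spectral pair if the functions $e^{2\pi i\lambda x}$, $\lambda\in\Lambda$, form an orthonormal basis of $L^2(\mu)$. A real number $t$ is a spectral eigenvalue of $(\mu,\Lambda)$ if both $(\mu,\Lambda)$ and $(\mu,t\Lambda)$ are spectral pairs. For $0<\delta<1$ let $A_N(\delta)$ be the set of primes $p\nmid N$ such that the multiplicative order of $N$ modulo $p$ is larger than $p^\delta$. Proposition 3.3. Let $(N,B,L)$ be a Hadamard triple with $0\in B\cap L$ and $\#B<N$, let $\Lambda$ be as above, and let $\dim_{\mathrm H}K(N,L)<\delta<1$. If the set $A_N(\delta)$ is infinite, then there exists $p_0>0$, depending only on $K(N,L)$, $\delta$ and $d=\gcd(B)$, such that every prime $p\in A_N(\delta)$ with $p\ge p_0$ is a spectral eigenvalue of $(\mu_{N,B},\Lambda)$. -/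

import Mathlib

open MeasureTheory ProbabilityTheory

noncomputable section

/-- The contraction `x ↦ (x + ℓ) / N`. -/
def ifsMap (N : ℕ) (ℓ : ℤ) (x : ℝ) : ℝ := (x + ℓ) / N

/-- The number `∑_{k ≥ 1} a_k N^{-k}` with digits `a_k ∈ A` (here the digits are indexed from `0`). -/
def digitSum (N : ℕ) (A : Finset ℤ) (ω : ℕ → A) : ℝ :=
  ∑' k : ℕ, ((ω k : ℤ) : ℝ) / (N : ℝ) ^ (k + 1)

/-- The self-similar set `K(N, A) = {∑_{k ≥ 1} a_k N^{-k} : a_k ∈ A}`. It is the unique non-empty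
compact set invariant under the maps `x ↦ (x + a) / N`, `a ∈ A`: see `selfSimilarSet_spec` and
`eq_selfSimilarSet`. -/
def selfSimilarSet (N : ℕ) (A : Finset ℤ) : Set ℝ := Set.range (digitSum N A)

/-- The self-similar measure `μ_{N,B}`: the law of `∑_{k ≥ 1} b_k N^{-k}`, where the digits `b_k`
are independent and uniformly distributed in `B`. It is the unique Borel probability measure with
`μ = (#B)⁻¹ ∑_{b ∈ B} μ ∘ τ_b⁻¹`, `τ_b x = (x + b) / N`: see `selfSimilarMeasure_spec` and
`eq_selfSimilarMeasure`. -/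
def selfSimilarMeasure (N : ℕ) (B : Finset ℤ) : Measure ℝ :=
  (Measure.infinitePi fun _ : ℕ => uniformOn (Set.univ : Set B)).map (digitSum N B)

/-- `(N, B, L)` is a Hadamard triple: `N ≥ 2`, `#B = #L ≥ 2`, and the matrix
`(#B)^{-1/2} (e^{2π i b ℓ / N})_{b ∈ B, ℓ ∈ L}` is unitary. -/
def IsHadamardTriple (N : ℕ) (B L : Finset ℤ) : Prop :=
  2 ≤ N ∧ 2 ≤ B.card ∧ B.card = L.card ∧
    ∃ M : Matrix B L ℂ,
      (∀ b ℓ, M b ℓ = (1 / (Real.sqrt B.card : ℂ)) *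
        Complex.exp (2 * Real.pi * Complex.I * (((b : ℤ) : ℂ) * ((ℓ : ℤ) : ℂ) / (N : ℂ)))) ∧
      M * M.conjTranspose = 1 ∧ M.conjTranspose * M = 1

/-- `m_B(x) = (#B)⁻¹ ∑_{b ∈ B} e^{2π i b x}`. -/
def maskFunction (B : Finset ℤ) (x : ℝ) : ℂ :=
  (1 / (B.card : ℂ)) * ∑ b ∈ B, Complex.exp (2 * Real.pi * Complex.I * (b : ℂ) * (x : ℂ))

/-- `C = {x_0, …, x_k}` is a cycle: for some `ℓ_0, …, ℓ_k ∈ L` the map `τ_{ℓ_j}` sends `x_j` to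
`x_{j+1}`, and `τ_{ℓ_k}` sends `x_k` to `x_0` (addition in `Fin (k + 1)` is cyclic). -/
def IsCycle (N : ℕ) (L : Finset ℤ) (C : Set ℝ) : Prop :=
  ∃ (k : ℕ) (x : Fin (k + 1) → ℝ) (ℓ : Fin (k + 1) → ℤ),
    C = Set.range x ∧ (∀ j, ℓ j ∈ L) ∧ ∀ j, ifsMap N (ℓ j) (x j) = x (j + 1)

/-- An `m_B`-cycle (extreme cycle): a cycle on which `|m_B| = 1`. -/
def IsExtremeCycle (N : ℕ) (B L : Finset ℤ) (C : Set ℝ) : Prop :=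
  IsCycle N L C ∧ ∀ x ∈ C, ‖maskFunction B x‖ = 1

/-- The canonical spectrum: the smallest set `Λ` that contains `-C` for all `m_B`-cycles `C` and
satisfies `N Λ + L ⊆ Λ`. -/
def canonicalSpectrum (N : ℕ) (B L : Finset ℤ) : Set ℝ :=
  ⋂₀ {S : Set ℝ | (∀ C, IsExtremeCycle N B L C → ∀ x ∈ C, -x ∈ S) ∧
    ∀ x ∈ S, ∀ ℓ ∈ L, (N : ℝ) * x + (ℓ : ℝ) ∈ S}

/-- `(μ, Λ)` is a spectral pair: `μ` is a probability measure, `Λ` is countable, and the functions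
`e_λ(x) = e^{2π i λ x}`, `λ ∈ Λ`, form an orthonormal (Hilbert) basis of `L²(μ)`. -/
def IsSpectralPair (μ : Measure ℝ) (Λ : Set ℝ) : Prop :=
  IsProbabilityMeasure μ ∧ Λ.Countable ∧
    ∃ b : HilbertBasis Λ ℂ (Lp ℂ 2 μ), ∀ s : Λ,
      (b s : ℝ → ℂ) =ᵐ[μ] fun x => Complex.exp (2 * Real.pi * Complex.I * ((s : ℝ) : ℂ) * (x : ℂ))

/-- `t` is a spectral eigenvalue of the spectral pair `(μ, Λ)`: both `(μ, Λ)` and `(μ, t Λ)` are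
spectral pairs. -/
def IsSpectralEigenvalue (μ : Measure ℝ) (Λ : Set ℝ) (t : ℝ) : Prop :=
  IsSpectralPair μ Λ ∧ IsSpectralPair μ ((fun x => t * x) '' Λ)

/-- `A_N(δ)`: the primes `p ∤ N` such that the order of `N` modulo `p` exceeds `p ^ δ`. -/
def largeOrderPrimes (N : ℕ) (δ : ℝ) : Set ℕ :=
  {p | p.Prime ∧ ¬ p ∣ N ∧ (p : ℝ) ^ δ < (orderOf (N : ZMod p) : ℝ)}

/-! The self-similar set and the self-similar measure defined above have their usual defining
properties, and are determined by them. -/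

theorem digit_bound (A : Finset ℤ) :
    ∃ M : ℝ, 0 ≤ M ∧ ∀ a ∈ A, |(a : ℝ)| ≤ M := by
  refine ⟨∑ a ∈ A, |(a : ℝ)|, Finset.sum_nonneg fun _ _ => abs_nonneg _, fun a ha => ?_⟩
  exact Finset.single_le_sum (f := fun a : ℤ => |(a : ℝ)|) (fun _ _ => abs_nonneg _) ha

theorem summable_geom {N : ℕ} (hN : 2 ≤ N) (M : ℝ) :
    Summable fun k : ℕ => M / (N : ℝ) ^ (k + 1) := by
  have h2 : (2 : ℝ) ≤ N := by exact_mod_cast hN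
  have h : Summable fun k : ℕ => ((N : ℝ)⁻¹) ^ k :=
    summable_geometric_of_lt_one (by positivity) (inv_lt_one_of_one_lt₀ (by linarith))
  refine (h.mul_left (M * (N : ℝ)⁻¹)).congr fun k => ?_
  rw [inv_pow, pow_succ]
  field_simp

theorem digit_term_le {N : ℕ} {A : Finset ℤ} {M : ℝ} (hM : ∀ a ∈ A, |(a : ℝ)| ≤ M)
    (ω : ℕ → A) (k : ℕ) :
    ‖((ω k : ℤ) : ℝ) / (N : ℝ) ^ (k + 1)‖ ≤ M / (N : ℝ) ^ (k + 1) := by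
  rw [norm_div, Real.norm_eq_abs, Real.norm_eq_abs, abs_of_nonneg (by positivity : (0 : ℝ) ≤ (N : ℝ) ^ (k + 1))]
  gcongr
  exact hM _ (ω k).2

theorem summable_digits {N : ℕ} (hN : 2 ≤ N) {A : Finset ℤ} (ω : ℕ → A) :
    Summable fun k : ℕ => ((ω k : ℤ) : ℝ) / (N : ℝ) ^ (k + 1) := by
  obtain ⟨M, -, hM⟩ := digit_bound A
  exact Summable.of_norm_bounded (summable_geom hN M) (digit_term_le hM ω)

theorem digitSum_eq {N : ℕ} (hN : 2 ≤ N) {A : Finset ℤ} (ω : ℕ → A) :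
    digitSum N A ω = ifsMap N (ω 0) (digitSum N A fun k => ω (k + 1)) := by
  have h2 : (N : ℝ) ≠ 0 := by positivity
  unfold digitSum ifsMap
  rw [(summable_digits hN ω).tsum_eq_zero_add, add_div, add_comm, ← tsum_div_const]
  congr 1
  · refine tsum_congr fun k => ?_
    rw [pow_succ _ (k + 1)]
    field_simp
  · simp

theorem continuous_digitSum {N : ℕ} (hN : 2 ≤ N) (A : Finset ℤ) : Continuous (digitSum N A) := by
  obtain ⟨M, -, hM⟩ := digit_bound A
  refine continuous_tsum (fun k => ?_) (summable_geom hN M) fun k ω => digit_term_le hM ω k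
  have : Continuous fun a : A => ((a : ℤ) : ℝ) := continuous_of_discreteTopology
  exact (this.comp (continuous_apply k)).div_const _

theorem selfSimilarSet_spec {N : ℕ} (hN : 2 ≤ N) {A : Finset ℤ} (hA : A.Nonempty) :
    (selfSimilarSet N A).Nonempty ∧ IsCompact (selfSimilarSet N A) ∧
      selfSimilarSet N A = ⋃ a ∈ A, ifsMap N a '' selfSimilarSet N A := by
  obtain ⟨a₀, ha₀⟩ := hA
  refine ⟨⟨_, fun _ => ⟨a₀, ha₀⟩, rfl⟩, isCompact_range (continuous_digitSum hN A), ?_⟩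
  ext x
  simp only [Set.mem_iUnion, Set.mem_image, selfSimilarSet, Set.mem_range]
  constructor
  · rintro ⟨ω, rfl⟩
    exact ⟨ω 0, (ω 0).2, _, ⟨_, rfl⟩, (digitSum_eq hN ω).symm⟩
  · rintro ⟨a, ha, _, ⟨ω, rfl⟩, rfl⟩
    exact ⟨fun k => Nat.casesOn k ⟨a, ha⟩ ω, digitSum_eq hN _⟩

theorem abs_digitSum_sub_le {N : ℕ} (hN : 2 ≤ N) {A : Finset ℤ} (y : ℕ → ℝ) (ω : ℕ → A)
    (h : ∀ k, y k = ifsMap N (ω k) (y (k + 1))) (n : ℕ) :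
    y 0 - digitSum N A ω = (y n - digitSum N A fun k => ω (k + n)) / (N : ℝ) ^ n := by
  have h2 : (N : ℝ) ≠ 0 := by positivity
  induction n with
  | zero => simp
  | succ n ih =>
    rw [ih, h n, digitSum_eq hN]
    simp only [ifsMap, zero_add, pow_succ]
    have : (fun k => ω (k + 1 + n)) = fun k => ω (k + (n + 1)) := by
      funext k; congr 1; ring
    rw [this]
    field_simp
    ring

theorem tendsto_div_pow {N : ℕ} (hN : 2 ≤ N) (c : ℝ) :
    Filter.Tendsto (fun n : ℕ => c / (N : ℝ) ^ n) Filter.atTop (nhds 0) := by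
  have h2 : (2 : ℝ) ≤ N := by exact_mod_cast hN
  exact tendsto_const_nhds.div_atTop (tendsto_pow_atTop_atTop_of_one_lt (by linarith))

theorem eq_selfSimilarSet {N : ℕ} (hN : 2 ≤ N) {A : Finset ℤ} {K : Set ℝ} (hne : K.Nonempty)
    (hK : IsCompact K) (h : K = ⋃ a ∈ A, ifsMap N a '' K) : K = selfSimilarSet N A := by
  have hmem : ∀ x, x ∈ K ↔ ∃ a : A, ∃ y ∈ K, ifsMap N a y = x := by
    intro x
    conv_lhs => rw [h]
    simp
  obtain ⟨R, hR⟩ := hK.isBounded.exists_norm_le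
  have hA : A.Nonempty := by
    obtain ⟨x, hx⟩ := hne
    obtain ⟨a, -⟩ := (hmem x).1 hx
    exact ⟨a, a.2⟩
  have : Nonempty A := hA.to_subtype
  obtain ⟨S, hS⟩ := (selfSimilarSet_spec hN hA).2.1.isBounded.exists_norm_le
  have hbd : ∀ y ∈ K, ∀ ω : ℕ → A, |y - digitSum N A ω| ≤ R + S := fun y hy ω =>
    (abs_sub _ _).trans (add_le_add (hR y hy) (hS _ ⟨ω, rfl⟩))
  ext x
  constructor
  · intro hx
    choose! a g hg hag using fun x hx => (hmem x).1 hx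
    let y : ℕ → ℝ := fun n => g^[n] x
    have hy : ∀ n, y n ∈ K := fun n => by
      induction n with
      | zero => exact hx
      | succ n ih => simp only [y, Function.iterate_succ_apply'] at ih ⊢; exact hg _ ih
    refine ⟨fun n => a (y n), ?_⟩
    have key := abs_digitSum_sub_le hN y (fun n => a (y n)) (fun k => by
      have := hag _ (hy k)
      simp only [y, Function.iterate_succ_apply'] at this ⊢
      exact this.symm)
    have hle : ∀ n : ℕ, |x - digitSum N A fun n => a (y n)| ≤ (R + S) / (N : ℝ) ^ n := by
      intro n
      have h0 : y 0 = x := rfl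
      rw [← h0, key n, abs_div, abs_of_nonneg (by positivity : (0 : ℝ) ≤ (N : ℝ) ^ n)]
      gcongr
      exact hbd _ (hy n) _
    have := ge_of_tendsto' (tendsto_div_pow hN (R + S)) hle
    exact (sub_eq_zero.1 (abs_nonpos_iff.1 this)).symm
  · rintro ⟨ω, rfl⟩
    obtain ⟨x₀, hx₀⟩ := hne
    have key : ∀ (n : ℕ) (ω : ℕ → A), ∃ y ∈ K, |y - digitSum N A ω| ≤ (R + S) / (N : ℝ) ^ n := by
      intro n
      induction n with
      | zero => exact fun ω => ⟨x₀, hx₀, by simpa using hbd x₀ hx₀ ω⟩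
      | succ n ih =>
        intro ω
        obtain ⟨y, hy, hle⟩ := ih fun k => ω (k + 1)
        refine ⟨ifsMap N (ω 0) y, (hmem _).2 ⟨ω 0, y, hy, rfl⟩, ?_⟩
        rw [digitSum_eq hN]
        simp only [ifsMap]
        rw [← sub_div, add_sub_add_right_eq_sub, abs_div, Nat.abs_cast, pow_succ, ← div_div]
        gcongr
    choose y hy hle using fun n => key n ω
    refine hK.isClosed.mem_of_tendsto (b := Filter.atTop) (f := y) ?_ (.of_forall hy)
    rw [tendsto_iff_dist_tendsto_zero]
    exact squeeze_zero (fun _ => dist_nonneg) hle (tendsto_div_pow hN (R + S))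

theorem isProbabilityMeasure_uniform_digits {B : Finset ℤ} (hB : B.Nonempty) :
    IsProbabilityMeasure (uniformOn (Set.univ : Set B)) :=
  have : Nonempty B := hB.to_subtype
  isProbabilityMeasure_uniformOn Set.finite_univ Set.univ_nonempty

theorem map_cons_infinitePi {X : Type*} [MeasurableSpace X] (u : Measure X)
    [IsProbabilityMeasure u] :
    (u.prod (Measure.infinitePi fun _ : ℕ => u)).map
      (fun p : X × (ℕ → X) => fun k : ℕ => (Nat.casesOn k p.1 p.2 : X)) =
      Measure.infinitePi fun _ : ℕ => u := by
  have hmeas : Measurable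
      (fun p : X × (ℕ → X) => fun k : ℕ => (Nat.casesOn k p.1 p.2 : X)) := by
    refine measurable_pi_lambda _ fun k => ?_
    cases k with
    | zero => exact measurable_fst
    | succ k => exact (measurable_pi_apply k).comp measurable_snd
  classical
  refine Measure.eq_infinitePi _ fun s t ht => ?_
  obtain ⟨n, hn⟩ := s.exists_nat_subset_range
  let t' : ℕ → Set X := fun i => if i ∈ s then t i else Set.univ
  have ht' : ∀ i, MeasurableSet (t' i) := fun i => by
    by_cases hi : i ∈ s <;> simp [t', hi, ht]
  have hset : (fun p : X × (ℕ → X) => fun k : ℕ => (Nat.casesOn k p.1 p.2 : X)) ⁻¹'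
      (Set.pi s t) = t' 0 ×ˢ Set.pi (Finset.range n) fun i => t' (i + 1) := by
    ext p
    simp only [Set.mem_preimage, Set.mem_pi, Set.mem_prod, Finset.mem_coe, Finset.mem_range]
    constructor
    · intro hp
      refine ⟨?_, fun i _ => ?_⟩
      · by_cases hi : 0 ∈ s
        · simpa [t', hi] using hp 0 hi
        · simp [t', hi]
      · by_cases hi : i + 1 ∈ s
        · simpa [t', hi] using hp (i + 1) hi
        · simp [t', hi]
    · rintro ⟨h0, h1⟩ i hi
      cases i with
      | zero => simpa [t', hi] using h0
      | succ i =>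
        have := h1 i (by have := Finset.mem_range.1 (hn hi); omega)
        simpa [t', hi] using this
  rw [Measure.map_apply hmeas (.pi s.countable_toSet fun i _ => ht i), hset, Measure.prod_prod,
    Measure.infinitePi_pi _ fun i _ => ht' (i + 1), mul_comm,
    ← Finset.prod_range_succ' (fun i => u (t' i)) n]
  have : ∏ i ∈ s, u (t i) = ∏ i ∈ s, u (t' i) :=
    Finset.prod_congr rfl fun i hi => by simp [t', hi]
  rw [this]
  refine (Finset.prod_subset (fun i hi => ?_) fun i _ hi => ?_).symm
  · have := Finset.mem_range.1 (hn hi)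
    exact Finset.mem_range.2 (by omega)
  · simp [t', hi]

theorem measurable_ifsMap (N : ℕ) (b : ℤ) : Measurable (ifsMap N b) := by
  unfold ifsMap
  fun_prop

theorem selfSimilarMeasure_spec {N : ℕ} (hN : 2 ≤ N) {B : Finset ℤ} (hB : B.Nonempty) :
    IsProbabilityMeasure (selfSimilarMeasure N B) ∧
      selfSimilarMeasure N B =
        (B.card : ENNReal)⁻¹ • ∑ b ∈ B, (selfSimilarMeasure N B).map (ifsMap N b) := by
  have hu := isProbabilityMeasure_uniform_digits hB
  have hX : Measurable (digitSum N B) := (continuous_digitSum hN B).measurable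
  refine ⟨Measure.isProbabilityMeasure_map hX.aemeasurable, ?_⟩
  have hpair : Measurable fun p : B × (ℕ → B) => ifsMap N p.1 (digitSum N B p.2) :=
    measurable_from_prod_countable_right fun b =>
      (measurable_ifsMap N b).comp hX
  have hcons : Measurable
      (fun p : B × (ℕ → B) => fun k : ℕ => (Nat.casesOn k p.1 p.2 : B)) := by
    refine measurable_pi_lambda _ fun k => ?_
    cases k with
    | zero => exact measurable_fst
    | succ k => exact (measurable_pi_apply k).comp measurable_snd
  have h1 : selfSimilarMeasure N B =
      ((uniformOn (Set.univ : Set B)).prod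
        (Measure.infinitePi fun _ : ℕ => uniformOn (Set.univ : Set B))).map
          (fun p : B × (ℕ → B) => ifsMap N p.1 (digitSum N B p.2)) := by
    conv_lhs => rw [selfSimilarMeasure, ← map_cons_infinitePi, Measure.map_map hX hcons]
    congr 1
    funext p
    exact digitSum_eq hN _
  ext E hE
  conv_lhs => rw [h1]
  rw [Measure.map_apply hpair hE, Measure.prod_apply (hpair hE), Measure.smul_apply,
    Measure.finsetSum_apply]
  have h2 : ∀ b : B, (Measure.infinitePi fun _ : ℕ => uniformOn (Set.univ : Set B))
      (Prod.mk b ⁻¹' ((fun p : B × (ℕ → B) => ifsMap N p.1 (digitSum N B p.2)) ⁻¹' E)) =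
      (selfSimilarMeasure N B).map (ifsMap N b) E := by
    intro b
    rw [Measure.map_apply (measurable_ifsMap N b) hE, selfSimilarMeasure,
      Measure.map_apply hX (measurable_ifsMap N b hE)]
    rfl
  simp_rw [h2]
  rw [uniformOn, ProbabilityTheory.cond, lintegral_smul_measure, Measure.restrict_univ, lintegral_fintype]
  simp only [Measure.count_singleton, mul_one, Measure.count_univ, ENat.card_eq_coe_fintype_card,
    Fintype.card_coe]
  congr 1
  exact Finset.sum_coe_sort B fun b => (selfSimilarMeasure N B).map (ifsMap N b) E

theorem charFun_of_selfSimilar {N : ℕ} {B : Finset ℤ} {μ : Measure ℝ}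
    [IsProbabilityMeasure μ]
    (h : μ = (B.card : ENNReal)⁻¹ • ∑ b ∈ B, μ.map (ifsMap N b)) (t : ℝ) :
    charFun μ t = ((B.card : ENNReal)⁻¹.toReal •
      ∑ b ∈ B, Complex.exp (((b : ℝ) / N * t : ℝ) * Complex.I)) * charFun μ (t / N) := by
  conv_lhs => rw [h]
  rw [charFun_apply_real, integral_smul_measure, integral_finsetSum_measure]
  · rw [smul_mul_assoc, Finset.sum_mul]
    congr 1
    refine Finset.sum_congr rfl fun b _ => ?_
    rw [integral_map (measurable_ifsMap N b).aemeasurable (by fun_prop), charFun_apply_real,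
      ← integral_const_mul]
    refine integral_congr_ae (.of_forall fun x => ?_)
    simp only [ifsMap]
    rw [← Complex.exp_add]
    congr 1
    push_cast
    ring
  · intro b _
    have := Measure.isProbabilityMeasure_map (μ := μ) (measurable_ifsMap N b).aemeasurable
    refine Integrable.of_bound (by fun_prop) 1 (.of_forall fun x => ?_)
    rw [← Complex.ofReal_mul, Complex.norm_exp_ofReal_mul_I]

theorem eq_selfSimilarMeasure {N : ℕ} (hN : 2 ≤ N) {B : Finset ℤ} (hB : B.Nonempty)
    {μ : Measure ℝ} [IsProbabilityMeasure μ]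
    (h : μ = (B.card : ENNReal)⁻¹ • ∑ b ∈ B, μ.map (ifsMap N b)) :
    μ = selfSimilarMeasure N B := by
  obtain ⟨hp, h'⟩ := selfSimilarMeasure_spec hN hB
  set ν := selfSimilarMeasure N B
  refine Measure.ext_of_charFun (funext fun t => ?_)
  have hm : ∀ t : ℝ, ‖((B.card : ENNReal)⁻¹.toReal •
      ∑ b ∈ B, Complex.exp (((b : ℝ) / N * t : ℝ) * Complex.I))‖ ≤ 1 := by
    intro t
    have hc : (B.card : ℝ) ≠ 0 := by exact_mod_cast hB.card_pos.ne'
    rw [norm_smul]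
    calc _ ≤ ‖((B.card : ENNReal)⁻¹.toReal)‖ * ∑ b ∈ B, (1 : ℝ) := by
          gcongr
          refine (norm_sum_le _ _).trans (Finset.sum_le_sum fun b _ => ?_)
          rw [Complex.norm_exp_ofReal_mul_I]
      _ = 1 := by simp [hc]
  have hstep : ∀ t : ℝ, ‖charFun μ t - charFun ν t‖ ≤ ‖charFun μ (t / N) - charFun ν (t / N)‖ := by
    intro t
    rw [charFun_of_selfSimilar h t, charFun_of_selfSimilar h' t, ← mul_sub, norm_mul]
    exact mul_le_of_le_one_left (norm_nonneg _) (hm t)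
  have hn : ∀ n : ℕ, ‖charFun μ t - charFun ν t‖ ≤
      ‖charFun μ (t / (N : ℝ) ^ n) - charFun ν (t / (N : ℝ) ^ n)‖ := by
    intro n
    induction n with
    | zero => simp
    | succ n ih =>
      refine ih.trans ((hstep _).trans_eq ?_)
      rw [div_div, ← pow_succ]
  have hcont : Continuous fun t : ℝ => ‖charFun μ t - charFun ν t‖ := by
    have := continuous_charFun (μ := μ)
    have := continuous_charFun (μ := ν)
    fun_prop
  have hlim := (hcont.tendsto 0).comp (tendsto_div_pow hN t)
  have := ge_of_tendsto' hlim hn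
  simp only [charFun_zero, probReal_univ, sub_self, norm_zero] at this
  exact sub_eq_zero.1 (norm_le_zero_iff.1 this)

end

/-!
A Hadamard triple `(N, B, L)` with `0 ∈ B` always generates a spectral pair: the function
`Q(x) = ∑_{λ ∈ Λ} |μ̂(x + λ)|²` is real analytic, is a fixed point of the transfer operator
`Q(x) = ∑_{ℓ ∈ L} |m_B(τ_ℓ x)|² Q(τ_ℓ x)`, and equals `1` at `-λ` for `λ ∈ Λ`. If `Q` were not
identically `1` on an interval invariant under the `τ_ℓ`, its minimum there would be less than `1`
and attained on a finite set invariant under the branches with `m_B(τ_ℓ x) ≠ 0`; such a set contains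
an `m_B`-cycle `C`, where `Q = 1` since `-C ⊆ Λ`.

For a prime `p ∤ N` the triple `(N, B, p L)` is again Hadamard, because `ζ` and `ζ ^ p` are Galois
conjugate for every `N`-th root of unity `ζ`, and the cycles of `p L` are the sets `p C`. So its
spectrum is `p Λ` unless some cycle `C` of `L` outside the dual lattice of `B` has `p C` in it.
Multiplication by `N` then moves a point of `C` through at least `ord_p(N) > p ^ δ` points of
`K(N, L) ∩ (p d)⁻¹ ℤ`. But `K(N, L)` contains only `O((p d) ^ s)` points of that lattice,
where `s = log_N #L ≤ dimH K(N, L) < δ`, so `p` is bounded.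
-/

open Filter Topology
open scoped FourierTransform SchwartzMap ContDiff Real

theorem ae_eq_zero_of_fourierIntegral_eq_zero {V F : Type*} [NormedAddCommGroup V]
    [InnerProductSpace ℝ V] [FiniteDimensional ℝ V] [MeasurableSpace V] [BorelSpace V]
    [NormedAddCommGroup F] [NormedSpace ℂ F] [CompleteSpace F] {μ : Measure V} [SigmaFinite μ]
    {f : V → F} (hf : Integrable f μ)
    (h : ∀ w, VectorFourier.fourierIntegral 𝐞 μ (innerₗ V) f w = 0) : f =ᵐ[μ] 0 := by
  refine ae_eq_zero_of_integral_contDiff_smul_eq_zero hf.locallyIntegrable fun g hg hgc ↦ ?_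
  let φ : 𝓢(V, ℂ) := (hgc.comp_left Complex.ofReal_zero).toSchwartzMap
    (Complex.ofRealCLM.contDiff.comp hg)
  let ψ : 𝓢(V, ℂ) := 𝓕⁻ φ
  have hψ (x) : VectorFourier.fourierIntegral 𝐞 volume (innerₗ V) ψ x = g x := by
    change 𝓕 (ψ : V → ℂ) x = φ x
    rw [← SchwartzMap.fourier_coe, FourierTransform.fourier_fourierInv_eq]
  have key := VectorFourier.integral_fourierIntegral_smul_eq_flip (L := innerₗ V) (ν := μ)
    Real.continuous_fourierChar continuous_inner (ψ.integrable (μ := volume)) hf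
  simpa only [hψ, flip_innerₗ, h, smul_zero, integral_zero, Complex.coe_smul] using key

theorem hasSum_norm_inner_sq_starProjection {ι E : Type*} [NormedAddCommGroup E]
    [InnerProductSpace ℂ E] {v : ι → E} (hv : Orthonormal ℂ v)
    [CompleteSpace (Submodule.span ℂ (Set.range v)).topologicalClosure] (f : E) :
    HasSum (fun i ↦ ‖(inner ℂ (v i) f : ℂ)‖ ^ 2)
      (‖(Submodule.span ℂ (Set.range v)).topologicalClosure.starProjection f‖ ^ 2) := by
  set U := (Submodule.span ℂ (Set.range v)).topologicalClosure
  have hmem (i) : v i ∈ U := Submodule.le_topologicalClosure _ (Submodule.subset_span ⟨i, rfl⟩)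
  let u (i : ι) : U := ⟨v i, hmem i⟩
  have hu : Orthonormal ℂ u := hv.codRestrict U hmem
  have himage : ((↑) : U → E) '' Submodule.span ℂ (Set.range u) =
      Submodule.span ℂ (Set.range v) := by
    rw [← Submodule.coe_subtype, ← Submodule.map_coe, Submodule.map_span, ← Set.range_comp]
    rfl
  have hdense : Dense (Submodule.span ℂ (Set.range u) : Set U) := by
    refine Topology.IsInducing.subtypeVal.dense_iff.2 fun x ↦ ?_
    exact himage ▸ x.2
  let b := HilbertBasis.mk hu (Submodule.dense_iff_topologicalClosure_eq_top.1 hdense).ge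
  have hb (i) : ((b i : U) : E) = v i := by rw [HilbertBasis.coe_mk]
  have key := Complex.hasSum_re (b.hasSum_inner_mul_inner (U.orthogonalProjectionOnto f)
    (U.orthogonalProjectionOnto f))
  have hterm (i) : (inner ℂ (U.orthogonalProjectionOnto f) (b i) *
      inner ℂ (b i) (U.orthogonalProjectionOnto f) : ℂ).re = ‖(inner ℂ (v i) f : ℂ)‖ ^ 2 := by
    rw [← inner_conj_symm, Submodule.inner_orthogonalProjectionOnto_eq_of_mem_left, hb,
      Complex.conj_mul']
    norm_cast
  rw [inner_self_eq_norm_sq_to_K] at key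
  simp only [hterm] at key
  exact_mod_cast key

/-- The Fourier–Stieltjes transform `μ̂(t) = ∫ e^{2πitx} dμ(x)`, in the normalisation of the
exponentials `e_λ`, so that it gives their inner products in `L²(μ)`. -/
noncomputable def fourierStieltjes (μ : Measure ℝ) (t : ℝ) : ℂ := charFun μ (2 * π * t)

section Exponentials

variable {μ : Measure ℝ}

theorem fourierStieltjes_zero [IsProbabilityMeasure μ] : fourierStieltjes μ 0 = 1 := by
  simp [fourierStieltjes]

theorem norm_fourierStieltjes_neg (t : ℝ) :
    ‖fourierStieltjes μ (-t)‖ = ‖fourierStieltjes μ t‖ := by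
  rw [fourierStieltjes, mul_neg, charFun_neg, RCLike.norm_conj, fourierStieltjes]

variable [IsFiniteMeasure μ]

/-- The exponential `e_t(x) = e^{2πitx}` as an element of `L²(μ)`. -/
noncomputable def expLp (μ : Measure ℝ) [IsFiniteMeasure μ] (t : ℝ) : Lp ℂ 2 μ :=
  MemLp.toLp (fun x : ℝ ↦ Complex.exp (2 * π * Complex.I * t * x)) <|
    MemLp.of_bound (by fun_prop) 1 <| .of_forall fun x ↦ by
      rw [show (2 * π * Complex.I * t * x : ℂ) = ↑(2 * π * t * x) * Complex.I by push_cast; ring,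
        Complex.norm_exp_ofReal_mul_I]

theorem coeFn_expLp (t : ℝ) :
    (expLp μ t : ℝ → ℂ) =ᵐ[μ] fun x ↦ Complex.exp (2 * π * Complex.I * t * x) :=
  MemLp.coeFn_toLp _

theorem inner_expLp (s t : ℝ) :
    (inner ℂ (expLp μ s) (expLp μ t) : ℂ) = fourierStieltjes μ (t - s) := by
  rw [L2.inner_def, fourierStieltjes, charFun_apply_real]
  refine integral_congr_ae ?_
  filter_upwards [coeFn_expLp s, coeFn_expLp t] with x hs ht
  rw [hs, ht, RCLike.inner_apply, ← Complex.exp_conj, ← Complex.exp_add]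
  simp only [map_mul, Complex.conj_ofReal, Complex.conj_I, map_ofNat]
  push_cast
  ring_nf

theorem eq_zero_of_inner_expLp {f : Lp ℂ 2 μ} (hf : ∀ t, (inner ℂ (expLp μ t) f : ℂ) = 0) :
    f = 0 := by
  rw [Lp.eq_zero_iff_ae_eq_zero]
  refine ae_eq_zero_of_fourierIntegral_eq_zero ((Lp.memLp f).integrable one_le_two) fun t ↦ ?_
  rw [← hf t, L2.inner_def, VectorFourier.fourierIntegral]
  refine integral_congr_ae ?_
  filter_upwards [coeFn_expLp t] with x hx
  rw [hx, RCLike.inner_apply, ← Complex.exp_conj, Circle.smul_def, Real.fourierChar_apply,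
    smul_eq_mul, mul_comm]
  simp only [map_mul, Complex.conj_ofReal, Complex.conj_I, map_ofNat, innerₗ_apply_apply,
    RCLike.inner_apply, conj_trivial]
  push_cast
  ring_nf

/-- Through the truncated function `x ↦ 2πi max(-R, min(x, R))`, the exponentials are the image
of the exponential map of the Banach algebra of bounded continuous functions. -/
theorem contDiff_expLp {R : ℝ} (hR : ∀ᵐ x ∂μ, |x| ≤ R) : ContDiff ℝ ω (expLp μ) := by
  let g : BoundedContinuousFunction ℝ ℂ := BoundedContinuousFunction.ofNormedAddCommGroup
    (fun x : ℝ ↦ 2 * π * Complex.I * ((max (-R) (min x R) : ℝ) : ℂ)) (by fun_prop)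
    (‖(2 * π * Complex.I : ℂ)‖ * |R|) fun x ↦ by
      rw [norm_mul, Complex.norm_real, Real.norm_eq_abs]
      refine mul_le_mul_of_nonneg_left (abs_le.2 ?_) (norm_nonneg _)
      exact ⟨(neg_le_neg (le_abs_self R)).trans (le_max_left _ _),
        max_le (neg_le_abs R) ((min_le_right _ _).trans (le_abs_self R))⟩
  let T : BoundedContinuousFunction ℝ ℂ →L[ℝ] Lp ℂ 2 μ :=
    (BoundedContinuousFunction.toLp 2 μ ℂ).restrictScalars ℝ
  have hexp (t : ℝ) : expLp μ t = T (NormedSpace.exp (t • g)) := by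
    refine Lp.ext ?_
    filter_upwards [coeFn_expLp t, hR,
      BoundedContinuousFunction.coeFn_toLp 2 μ ℂ (NormedSpace.exp (t • g))] with x hx hxR hT
    let ev : BoundedContinuousFunction ℝ ℂ →+* ℂ :=
      { toFun := fun f ↦ f x, map_one' := rfl, map_mul' := fun _ _ ↦ rfl,
        map_zero' := rfl, map_add' := fun _ _ ↦ rfl }
    have hev : Continuous ev := (BoundedContinuousFunction.evalCLM ℂ x).continuous
    have hgx : ev (t • g) = 2 * π * Complex.I * t * x := by
      change (t : ℝ) • (2 * π * Complex.I * ((max (-R) (min x R) : ℝ) : ℂ)) = _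
      rw [min_eq_left (abs_le.1 hxR).2, max_eq_right (abs_le.1 hxR).1, Complex.real_smul]
      ring
    rw [hx, ← hgx, Complex.exp_eq_exp_ℂ, ← NormedSpace.map_exp ev hev]
    exact hT.symm
  have hlin : ContDiff ℝ ω fun t : ℝ ↦ t • g := contDiff_id.smul contDiff_const
  have hNS : ContDiff ℝ ω (NormedSpace.exp : BoundedContinuousFunction ℝ ℂ → _) :=
    AnalyticOnNhd.contDiff fun x _ ↦ NormedSpace.exp_analytic (𝕂 := ℝ) x
  rw [funext hexp]
  exact T.contDiff.comp (hNS.comp hlin)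

end Exponentials

section SpectralPairs

variable {μ : Measure ℝ} [IsProbabilityMeasure μ] {Λ : Set ℝ}

theorem norm_expLp (t : ℝ) : ‖expLp μ t‖ = 1 := by
  have h : (inner ℂ (expLp μ t) (expLp μ t) : ℂ) = 1 := by
    rw [inner_expLp, sub_self, fourierStieltjes_zero]
  rw [inner_self_eq_norm_sq_to_K] at h
  exact (pow_eq_one_iff_of_nonneg (norm_nonneg _) two_ne_zero).1
    (Complex.ofReal_injective (by simpa using h))

theorem orthonormal_expLp
    (h : Λ.Pairwise fun s t ↦ fourierStieltjes μ (t - s) = 0) :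
    Orthonormal ℂ fun s : Λ ↦ expLp μ s :=
  ⟨fun _ ↦ norm_expLp _, fun s t hst ↦
    (inner_expLp _ _).trans (h s.2 t.2 (Subtype.coe_ne_coe.2 hst))⟩

theorem hasSum_norm_fourierStieltjes_sq
    (h : Λ.Pairwise fun s t ↦ fourierStieltjes μ (t - s) = 0) (x : ℝ) :
    HasSum (fun s : Λ ↦ ‖fourierStieltjes μ (x + s)‖ ^ 2)
      (‖(Submodule.span ℂ (Set.range fun s : Λ ↦ expLp μ s)).topologicalClosure.starProjection
        (expLp μ (-x))‖ ^ 2) := by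
  convert hasSum_norm_inner_sq_starProjection (orthonormal_expLp h) (expLp μ (-x)) using 3 with s
  rw [inner_expLp, ← norm_fourierStieltjes_neg, neg_add']

/-- The criterion of Jorgensen and Pedersen: `∑_{λ ∈ Λ} |μ̂(x + λ)|² = 1` is the equality case of
Bessel's inequality for `e_{-x}`. -/
theorem isSpectralPair_of_hasSum (hΛ : Λ.Countable)
    (h : Λ.Pairwise fun s t ↦ fourierStieltjes μ (t - s) = 0)
    (hsum : ∀ x, HasSum (fun s : Λ ↦ ‖fourierStieltjes μ (x + s)‖ ^ 2) 1) :
    IsSpectralPair μ Λ := by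
  have hv := orthonormal_expLp h
  set U := Submodule.span ℂ (Set.range fun s : Λ ↦ expLp μ s)
  have hmem (t : ℝ) : expLp μ t ∈ U.topologicalClosure := by
    rw [Submodule.mem_iff_norm_starProjection, norm_expLp]
    have := (hasSum_norm_fourierStieltjes_sq h (-t)).unique (hsum (-t))
    rw [neg_neg] at this
    exact (pow_eq_one_iff_of_nonneg (norm_nonneg _) two_ne_zero).1 this
  have hbot : Uᗮ = ⊥ := by
    rw [← Submodule.orthogonal_closure, Submodule.eq_bot_iff]
    exact fun f hf ↦ eq_zero_of_inner_expLp fun t ↦ hf _ (hmem t)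
  refine ⟨inferInstance, hΛ, HilbertBasis.mkOfOrthogonalEqBot hv hbot, fun s ↦ ?_⟩
  rw [HilbertBasis.coe_mkOfOrthogonalEqBot]
  exact coeFn_expLp _

theorem exists_contDiff_hasSum {R : ℝ} (hR : ∀ᵐ x ∂μ, |x| ≤ R)
    (h : Λ.Pairwise fun s t ↦ fourierStieltjes μ (t - s) = 0) :
    ∃ Q : ℝ → ℝ, ContDiff ℝ ω Q ∧ (∀ x, Q x ≤ 1) ∧
      ∀ x, HasSum (fun s : Λ ↦ ‖fourierStieltjes μ (x + s)‖ ^ 2) (Q x) := by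
  set U := (Submodule.span ℂ (Set.range fun s : Λ ↦ expLp μ s)).topologicalClosure
  refine ⟨fun x ↦ ‖U.starProjection (expLp μ (-x))‖ ^ 2, ?_, fun x ↦ ?_,
    hasSum_norm_fourierStieltjes_sq h⟩
  · exact ((U.starProjection.restrictScalars ℝ).contDiff.comp
      ((contDiff_expLp hR).comp contDiff_neg)).norm_sq ℂ
  · refine pow_le_one₀ (norm_nonneg _) ?_
    exact (U.norm_starProjection_apply_le _).trans_eq (norm_expLp _)

end SpectralPairs

theorem fourierChar_eq_one_iff {x : ℝ} : 𝐞 x = 1 ↔ ∃ k : ℤ, x = k := by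
  have hpi : (2 * π : ℝ) ≠ 0 := Real.two_pi_pos.ne'
  simp only [Real.fourierChar_apply', Circle.exp_eq_one, mul_comm (2 * π), mul_left_inj' hpi]

theorem eq_of_norm_sum_eq_card {ι E : Type*} [NormedAddCommGroup E] [InnerProductSpace ℝ E]
    {s : Finset ι} {z : ι → E} (hz : ∀ i ∈ s, ‖z i‖ = 1) (h : ‖∑ i ∈ s, z i‖ = s.card)
    {i j : ι} (hi : i ∈ s) (hj : j ∈ s) : z i = z j := by
  have hs : (s.card : ℝ) ≠ 0 := by exact_mod_cast (Finset.card_pos.2 ⟨i, hi⟩).ne'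
  set u := (s.card : ℝ)⁻¹ • ∑ i ∈ s, z i
  have hu : ‖u‖ = 1 := by
    rw [norm_smul, norm_inv, Real.norm_natCast, h, inv_mul_cancel₀ hs]
  have hle : ∀ i ∈ s, inner ℝ u (z i) ≤ 1 := fun i hi ↦ by
    simpa [hu, hz i hi] using real_inner_le_norm u (z i)
  have hsum : ∑ i ∈ s, inner ℝ u (z i) = ∑ i ∈ s, 1 := by
    rw [← inner_sum, real_inner_smul_left, real_inner_self_eq_norm_sq, h, Finset.sum_const,
      nsmul_one]
    field_simp
  have heq : ∀ i ∈ s, u = z i := fun i hi ↦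
    (inner_eq_one_iff_of_norm_eq_one (𝕜 := ℝ) hu (hz i hi)).1
      ((Finset.sum_eq_sum_iff_of_le hle).1 hsum i hi)
  rw [← heq i hi, heq j hj]

section Mask

variable {B : Finset ℤ}

/-- The group of all real `x` with `b x ∈ ℤ` for every `b ∈ B`: these are the periods of the mask
function `m_B`, and the points where `|m_B| = 1` if `0 ∈ B`. -/
def dualLattice (B : Finset ℤ) : AddSubgroup ℝ :=
  ⨅ b ∈ B, (Int.castAddHom ℝ).range.comap (AddMonoidHom.mulLeft (b : ℝ))

theorem mem_dualLattice {x : ℝ} : x ∈ dualLattice B ↔ ∀ b ∈ B, ∃ k : ℤ, (b : ℝ) * x = k := by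
  simp only [dualLattice, AddSubgroup.mem_iInf, AddSubgroup.mem_comap, AddMonoidHom.mem_range,
    Int.coe_castAddHom, AddMonoidHom.coe_mulLeft, eq_comm]

theorem intCast_mem_dualLattice (k : ℤ) : (k : ℝ) ∈ dualLattice B :=
  mem_dualLattice.2 fun b _ ↦ ⟨b * k, by push_cast; rfl⟩

theorem countable_dualLattice (hB : ∃ b ∈ B, b ≠ 0) : (dualLattice B : Set ℝ).Countable := by
  obtain ⟨b, hb, hb0⟩ := hB
  refine (Set.countable_range fun k : ℤ ↦ (k : ℝ) / b).mono fun x hx ↦ ?_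
  obtain ⟨k, hk⟩ := mem_dualLattice.1 hx b hb
  exact ⟨k, by simp only [← hk]; field_simp⟩

theorem maskFunction_eq (x : ℝ) :
    maskFunction B x = (B.card : ℂ)⁻¹ * ∑ b ∈ B, (𝐞 (b * x) : ℂ) := by
  rw [maskFunction, one_div]
  congr! 2 with b
  rw [Real.fourierChar_apply]
  push_cast
  ring_nf

theorem maskFunction_add {g : ℝ} (hg : g ∈ dualLattice B) (x : ℝ) :
    maskFunction B (x + g) = maskFunction B x := by
  simp only [maskFunction_eq]
  congr 1
  refine Finset.sum_congr rfl fun b hb ↦ ?_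
  rw [mul_add, AddChar.map_add_eq_mul, fourierChar_eq_one_iff.2 (mem_dualLattice.1 hg b hb),
    mul_one]

theorem maskFunction_zero (hB : B.Nonempty) : maskFunction B 0 = 1 := by
  simp [maskFunction_eq, hB.ne_empty]

theorem maskFunction_of_mem_dualLattice (hB : B.Nonempty) {g : ℝ} (hg : g ∈ dualLattice B) :
    maskFunction B g = 1 := by
  rw [← zero_add g, maskFunction_add hg, maskFunction_zero hB]

theorem norm_maskFunction_eq_one_iff (h0 : 0 ∈ B) {x : ℝ} :
    ‖maskFunction B x‖ = 1 ↔ x ∈ dualLattice B := by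
  refine ⟨fun h ↦ mem_dualLattice.2 fun b hb ↦ fourierChar_eq_one_iff.1 ?_, fun h ↦ by
    rw [maskFunction_of_mem_dualLattice ⟨0, h0⟩ h, norm_one]⟩
  have hc : (B.card : ℝ) ≠ 0 := by exact_mod_cast (Finset.card_pos.2 ⟨0, h0⟩).ne'
  have hsum : ‖∑ b ∈ B, (𝐞 (b * x) : ℂ)‖ = B.card := by
    rw [maskFunction_eq, norm_mul, norm_inv, Complex.norm_natCast] at h
    field_simp at h
    exact h
  have h1 := eq_of_norm_sum_eq_card (z := fun b : ℤ ↦ (𝐞 (b * x) : ℂ))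
    (fun b _ ↦ Circle.norm_coe _) hsum hb h0
  simpa only [Int.cast_zero, zero_mul, AddChar.map_zero_eq_one, Circle.coe_inj] using h1

theorem fourierStieltjes_selfSimilarMeasure {N : ℕ} (hN : 2 ≤ N) (hB : B.Nonempty) (t : ℝ) :
    fourierStieltjes (selfSimilarMeasure N B) t =
      maskFunction B (t / N) * fourierStieltjes (selfSimilarMeasure N B) (t / N) := by
  obtain ⟨_, h⟩ := selfSimilarMeasure_spec hN hB
  rw [fourierStieltjes, charFun_of_selfSimilar h, mul_div_assoc, fourierStieltjes, maskFunction,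
    ENNReal.toReal_inv, ENNReal.toReal_natCast, Complex.real_smul]
  push_cast
  rw [one_div]
  congr! 4
  ring

end Mask

theorem dotProduct_star_self {k : Type*} [Fintype k] (w : k → ℂ) :
    w ⬝ᵥ star w = ((∑ i, ‖w i‖ ^ 2 : ℝ) : ℂ) := by
  rw [dotProduct, Complex.ofReal_sum]
  exact Finset.sum_congr rfl fun i _ ↦ (Complex.mul_conj' _).trans (Complex.ofReal_pow _ _).symm

theorem sum_norm_vecMul_sq {m n : Type*} [Fintype m] [Fintype n] [DecidableEq m]
    {M : Matrix m n ℂ} (hM : M * M.conjTranspose = 1) (v : m → ℂ) :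
    ∑ j, ‖Matrix.vecMul v M j‖ ^ 2 = ∑ i, ‖v i‖ ^ 2 := by
  have h : Matrix.vecMul v M ⬝ᵥ star (Matrix.vecMul v M) = v ⬝ᵥ star v := by
    rw [Matrix.star_vecMul, ← Matrix.dotProduct_mulVec, Matrix.mulVec_mulVec, hM,
      Matrix.one_mulVec]
  rw [dotProduct_star_self, dotProduct_star_self] at h
  exact_mod_cast h

section Hadamard

variable {N : ℕ} {B L : Finset ℤ}

/-- The matrix `(#B)^{-1/2} (e^{2πi bℓ/N})_{b ∈ B, ℓ ∈ L}` whose unitarity defines a Hadamard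
triple. -/
noncomputable def hadamardMatrix (N : ℕ) (B L : Finset ℤ) : Matrix B L ℂ :=
  Matrix.of fun b ℓ ↦ (√B.card : ℂ)⁻¹ * 𝐞 ((b : ℤ) * ((ℓ : ℤ) : ℝ) / N)

theorem inv_sqrt_card_mul_self :
    (√B.card : ℂ)⁻¹ * (√B.card : ℂ)⁻¹ = (B.card : ℂ)⁻¹ := by
  rw [← mul_inv, ← Complex.ofReal_mul, Real.mul_self_sqrt (Nat.cast_nonneg _),
    Complex.ofReal_natCast]

theorem conjTranspose_mul_hadamardMatrix (ℓ ℓ' : L) :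
    ((hadamardMatrix N B L).conjTranspose * hadamardMatrix N B L) ℓ ℓ' =
      maskFunction B ((((ℓ' : ℤ) : ℝ) - ((ℓ : ℤ) : ℝ)) / N) := by
  rw [Matrix.mul_apply, maskFunction_eq, ← Finset.sum_coe_sort B, Finset.mul_sum]
  refine Finset.sum_congr rfl fun b _ ↦ ?_
  rw [Matrix.conjTranspose_apply, hadamardMatrix, Matrix.of_apply, Matrix.of_apply, star_mul',
    mul_mul_mul_comm, Complex.star_def, map_inv₀, Complex.conj_ofReal,
    inv_sqrt_card_mul_self, ← Circle.coe_inv_eq_conj, ← AddChar.map_neg_eq_inv, ← Circle.coe_mul,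
    ← AddChar.map_add_eq_mul]
  congr 3
  ring

theorem maskFunction_ifsMap (ℓ : L) (x : ℝ) :
    maskFunction B (ifsMap N ℓ x) = (√B.card : ℂ)⁻¹ *
      Matrix.vecMul (fun b : B ↦ (𝐞 ((b : ℤ) * (x / N)) : ℂ)) (hadamardMatrix N B L) ℓ := by
  rw [maskFunction_eq, Matrix.vecMul, dotProduct, ← Finset.sum_coe_sort B, Finset.mul_sum,
    Finset.mul_sum]
  refine Finset.sum_congr rfl fun b _ ↦ ?_
  rw [hadamardMatrix, Matrix.of_apply, mul_left_comm (𝐞 _ : ℂ), ← mul_assoc,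
    inv_sqrt_card_mul_self, ← Circle.coe_mul, ← AddChar.map_add_eq_mul, ifsMap]
  congr 3
  ring

theorem isHadamardTriple_iff_hadamardMatrix : IsHadamardTriple N B L ↔
    2 ≤ N ∧ 2 ≤ B.card ∧ B.card = L.card ∧
      hadamardMatrix N B L * (hadamardMatrix N B L).conjTranspose = 1 ∧
      (hadamardMatrix N B L).conjTranspose * hadamardMatrix N B L = 1 := by
  have hM (M : Matrix B L ℂ) : (∀ b ℓ, M b ℓ = 1 / (√B.card : ℂ) *
      Complex.exp (2 * π * Complex.I * (((b : ℤ) : ℂ) * ((ℓ : ℤ) : ℂ) / N))) ↔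
        M = hadamardMatrix N B L := by
    rw [← Matrix.ext_iff]
    refine forall₂_congr fun b ℓ ↦ ?_
    rw [hadamardMatrix, Matrix.of_apply, Real.fourierChar_apply, one_div]
    push_cast
    ring_nf
  simp only [IsHadamardTriple, hM, exists_eq_left]

theorem isHadamardTriple_iff : IsHadamardTriple N B L ↔ 2 ≤ N ∧ 2 ≤ B.card ∧ B.card = L.card ∧
    ∀ ℓ ∈ L, ∀ ℓ' ∈ L, ℓ ≠ ℓ' → maskFunction B (((ℓ : ℝ) - ℓ') / N) = 0 := by
  rw [isHadamardTriple_iff_hadamardMatrix]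
  refine and_congr_right fun _ ↦ and_congr_right fun hB ↦ and_congr_right fun hBL ↦ ?_
  rw [Matrix.mul_eq_one_comm_of_card_eq _ _ _ (by simpa using hBL), and_self]
  constructor
  · intro h ℓ hℓ ℓ' hℓ' hne
    rw [← conjTranspose_mul_hadamardMatrix ⟨ℓ', hℓ'⟩ ⟨ℓ, hℓ⟩, h,
      Matrix.one_apply_ne (by simpa using hne.symm)]
  · intro h
    ext ℓ ℓ'
    rw [conjTranspose_mul_hadamardMatrix]
    rcases eq_or_ne ℓ ℓ' with rfl | hne
    · rw [sub_self, zero_div, maskFunction_zero (Finset.card_pos.1 (two_pos.trans_le hB)),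
        Matrix.one_apply_eq]
    · rw [h _ ℓ'.2 _ ℓ.2 (Subtype.coe_injective.ne hne.symm), Matrix.one_apply_ne hne]

namespace IsHadamardTriple

variable (h : IsHadamardTriple N B L)
include h

theorem two_le : 2 ≤ N := h.1

theorem cast_pos : (0 : ℝ) < N := by exact_mod_cast two_pos.trans_le h.two_le

theorem two_le_card : 2 ≤ B.card := h.2.1

theorem card_eq : B.card = L.card := h.2.2.1

theorem nonempty : B.Nonempty := Finset.card_pos.1 (two_pos.trans_le h.two_le_card)

theorem exists_mem_ne_zero : ∃ b ∈ B, b ≠ 0 := Finset.exists_mem_ne h.two_le_card 0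

theorem maskFunction_sub_div_eq_zero {ℓ ℓ' : ℤ} (hℓ : ℓ ∈ L) (hℓ' : ℓ' ∈ L) (hne : ℓ ≠ ℓ') :
    maskFunction B (((ℓ : ℝ) - ℓ') / N) = 0 :=
  (isHadamardTriple_iff.1 h).2.2.2 ℓ hℓ ℓ' hℓ' hne

theorem eq_of_sub_div_mem_dualLattice {ℓ ℓ' : ℤ} (hℓ : ℓ ∈ L) (hℓ' : ℓ' ∈ L)
    (hd : ((ℓ : ℝ) - ℓ') / N ∈ dualLattice B) : ℓ = ℓ' := by
  by_contra hne
  have h0 := h.maskFunction_sub_div_eq_zero hℓ hℓ' hne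
  rw [maskFunction_of_mem_dualLattice h.nonempty hd] at h0
  exact one_ne_zero h0

theorem eq_of_dvd_sub {ℓ ℓ' : ℤ} (hℓ : ℓ ∈ L) (hℓ' : ℓ' ∈ L) (hd : (N : ℤ) ∣ ℓ - ℓ') : ℓ = ℓ' := by
  obtain ⟨k, hk⟩ := hd
  refine h.eq_of_sub_div_mem_dualLattice hℓ hℓ' ?_
  rw [← Int.cast_sub, hk, Int.cast_mul, Int.cast_natCast, mul_div_cancel_left₀ _ h.cast_pos.ne']
  exact intCast_mem_dualLattice k

theorem sum_norm_maskFunction_ifsMap_sq (x : ℝ) :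
    ∑ ℓ ∈ L, ‖maskFunction B (ifsMap N ℓ x)‖ ^ 2 = 1 := by
  have hM := (isHadamardTriple_iff_hadamardMatrix.1 h).2.2.2.1
  have hB : (B.card : ℝ) ≠ 0 := by exact_mod_cast h.nonempty.card_pos.ne'
  rw [← Finset.sum_coe_sort L]
  simp only [maskFunction_ifsMap, norm_mul, mul_pow, ← Finset.mul_sum, sum_norm_vecMul_sq hM,
    Circle.norm_coe, norm_inv, Complex.norm_real, inv_pow, Real.norm_eq_abs, sq_abs,
    Real.sq_sqrt (Nat.cast_nonneg B.card), one_pow]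
  simp [hB]

/-- Peeling off equal digits divides the nonzero integer `b (x - y)` by `N`, so two distinct points
of `Λ` have distinct digits after finitely many steps. -/
theorem fourierStieltjes_eq_zero {Λ : Set ℝ} (hΛ : Λ ⊆ dualLattice B)
    (hsub : ∀ x ∈ Λ, ∃ y ∈ Λ, ∃ ℓ ∈ L, x = (N : ℝ) * y + ℓ) :
    Λ.Pairwise fun s t ↦ fourierStieltjes (selfSimilarMeasure N B) (t - s) = 0 := by
  have hN := h.cast_pos
  obtain ⟨b, hb, hb0⟩ := h.exists_mem_ne_zero
  have hdual {x y : ℝ} (hx : x ∈ Λ) (hy : y ∈ Λ) : ∃ k : ℤ, (b : ℝ) * (x - y) = k :=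
    mem_dualLattice.1 (sub_mem (hΛ hx) (hΛ hy)) b hb
  suffices H : ∀ n : ℕ, ∀ x ∈ Λ, ∀ y ∈ Λ, ∀ k : ℤ, k ≠ 0 → (b : ℝ) * (x - y) = k → k.natAbs = n →
      fourierStieltjes (selfSimilarMeasure N B) (x - y) = 0 by
    intro y hy x hx hne
    obtain ⟨k, hk⟩ := hdual hx hy
    refine H k.natAbs x hx y hy k ?_ hk rfl
    rintro rfl
    exact mul_ne_zero (Int.cast_ne_zero.2 hb0) (sub_ne_zero.2 hne.symm) (by rw [hk, Int.cast_zero])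
  intro n
  induction n using Nat.strong_induction_on with
  | _ n ih =>
    rintro x hx y hy k hk0 hk rfl
    obtain ⟨x', hx', ℓ, hℓ, rfl⟩ := hsub x hx
    obtain ⟨y', hy', ℓ', hℓ', rfl⟩ := hsub y hy
    have hdiv : ((N : ℝ) * x' + ℓ - (N * y' + ℓ')) / N = ((ℓ : ℝ) - ℓ') / N + (x' - y') := by
      field_simp
      ring
    rw [fourierStieltjes_selfSimilarMeasure h.two_le h.nonempty, hdiv,
      maskFunction_add (sub_mem (hΛ hx') (hΛ hy'))]
    rcases eq_or_ne ℓ ℓ' with rfl | hne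
    · obtain ⟨k', hk'⟩ := hdual hx' hy'
      obtain rfl : k = N * k' := by
        have : (k : ℝ) = N * k' := by rw [← hk, ← hk']; ring
        exact_mod_cast this
      have hk'0 : k' ≠ 0 := right_ne_zero_of_mul hk0
      rw [sub_self, zero_div, zero_add, ih k'.natAbs ?_ x' hx' y' hy' k' hk'0 hk' rfl, mul_zero]
      rw [Int.natAbs_mul, Int.natAbs_natCast]
      exact lt_mul_left (Int.natAbs_pos.2 hk'0) h.two_le
    · rw [h.maskFunction_sub_div_eq_zero hℓ hℓ' hne, zero_mul]

end IsHadamardTriple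
end Hadamard

section CanonicalSpectrum

variable {N : ℕ} {B L : Finset ℤ}

theorem isExtremeCycle_zero (hB : B.Nonempty) (hL : 0 ∈ L) : IsExtremeCycle N B L {0} := by
  refine ⟨⟨0, fun _ ↦ 0, fun _ ↦ 0, by simp, fun _ ↦ hL, fun _ ↦ by simp [ifsMap]⟩, ?_⟩
  rintro x rfl
  rw [maskFunction_zero hB, norm_one]

theorem neg_mem_canonicalSpectrum {C : Set ℝ} (hC : IsExtremeCycle N B L C) {x : ℝ} (hx : x ∈ C) :
    -x ∈ canonicalSpectrum N B L :=
  Set.mem_sInter.2 fun _ hS ↦ hS.1 C hC x hx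

theorem mul_add_mem_canonicalSpectrum {x : ℝ} (hx : x ∈ canonicalSpectrum N B L) {ℓ : ℤ}
    (hℓ : ℓ ∈ L) : (N : ℝ) * x + ℓ ∈ canonicalSpectrum N B L :=
  Set.mem_sInter.2 fun S hS ↦ hS.2 x (Set.mem_sInter.1 hx S hS) ℓ hℓ

theorem canonicalSpectrum_subset {S : Set ℝ} (h1 : ∀ C, IsExtremeCycle N B L C → ∀ x ∈ C, -x ∈ S)
    (h2 : ∀ x ∈ S, ∀ ℓ ∈ L, (N : ℝ) * x + ℓ ∈ S) : canonicalSpectrum N B L ⊆ S :=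
  Set.sInter_subset_of_mem ⟨h1, h2⟩

theorem canonicalSpectrum_subset_dualLattice (h0 : 0 ∈ B) :
    canonicalSpectrum N B L ⊆ dualLattice B := by
  refine canonicalSpectrum_subset
    (fun C hC x hx ↦ neg_mem ((norm_maskFunction_eq_one_iff h0).1 (hC.2 x hx)))
    fun x hx ℓ _ ↦ add_mem ?_ (intCast_mem_dualLattice ℓ)
  rw [← nsmul_eq_mul]
  exact nsmul_mem hx N

theorem exists_eq_mul_add_of_mem_canonicalSpectrum (hN : N ≠ 0) {x : ℝ}
    (hx : x ∈ canonicalSpectrum N B L) :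
    ∃ y ∈ canonicalSpectrum N B L, ∃ ℓ ∈ L, x = (N : ℝ) * y + ℓ := by
  suffices H : canonicalSpectrum N B L ⊆ {x | x ∈ canonicalSpectrum N B L ∧
      ∃ y ∈ canonicalSpectrum N B L, ∃ ℓ ∈ L, x = (N : ℝ) * y + ℓ} from (H hx).2
  refine canonicalSpectrum_subset (fun C hC x hx ↦ ⟨neg_mem_canonicalSpectrum hC hx, ?_⟩)
    fun x hx ℓ hℓ ↦ ⟨mul_add_mem_canonicalSpectrum hx.1 hℓ, x, hx.1, ℓ, hℓ, rfl⟩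
  obtain ⟨k, y, ℓ, rfl, hℓ, hy⟩ := hC.1
  obtain ⟨j, rfl⟩ := hx
  refine ⟨-y (j + 1), neg_mem_canonicalSpectrum hC ⟨_, rfl⟩, ℓ j, hℓ j, ?_⟩
  rw [← hy j, ifsMap]
  field_simp
  ring

namespace IsHadamardTriple

variable (h : IsHadamardTriple N B L)
include h

theorem bijective_mul_add_canonicalSpectrum (h0 : 0 ∈ B) :
    Function.Bijective fun p : L × canonicalSpectrum N B L ↦
      (⟨N * p.2 + ((p.1 : ℤ) : ℝ), mul_add_mem_canonicalSpectrum p.2.2 p.1.2⟩ :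
        canonicalSpectrum N B L) := by
  have hN := h.cast_pos
  constructor
  · rintro ⟨⟨ℓ, hℓ⟩, x, hx⟩ ⟨⟨ℓ', hℓ'⟩, x', hx'⟩ heq
    replace heq : (N : ℝ) * x + ℓ = N * x' + ℓ' := congrArg Subtype.val heq
    have hsub : ((ℓ : ℝ) - ℓ') / N = x' - x := by
      rw [div_eq_iff hN.ne']
      linarith
    have hmem : x' - x ∈ dualLattice B := sub_mem (canonicalSpectrum_subset_dualLattice h0 hx')
      (canonicalSpectrum_subset_dualLattice h0 hx)
    obtain rfl := h.eq_of_sub_div_mem_dualLattice hℓ hℓ' (hsub ▸ hmem)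
    rw [add_left_inj, mul_right_inj' hN.ne'] at heq
    subst heq
    rfl
  · rintro ⟨x, hx⟩
    obtain ⟨y, hy, ℓ, hℓ, rfl⟩ :=
      exists_eq_mul_add_of_mem_canonicalSpectrum (two_pos.trans_le h.two_le).ne' hx
    exact ⟨⟨⟨ℓ, hℓ⟩, ⟨y, hy⟩⟩, rfl⟩

end IsHadamardTriple
end CanonicalSpectrum

section CoprimeFractions

/-- The rational numbers whose denominator is prime to `N`, as a subgroup of `ℝ`; it contains all
points of cycles. -/
def coprimeFractions (N : ℕ) : AddSubgroup ℝ where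
  carrier := {x | ∃ q : ℕ, N.Coprime q ∧ ∃ k : ℤ, (q : ℝ) * x = k}
  zero_mem' := ⟨1, Nat.coprime_one_right N, 0, by simp⟩
  add_mem' := by
    rintro x y ⟨q, hq, k, hk⟩ ⟨r, hr, l, hl⟩
    refine ⟨q * r, hq.mul_right hr, r * k + q * l, ?_⟩
    push_cast
    rw [← hk, ← hl]
    ring
  neg_mem' := by
    rintro x ⟨q, hq, k, hk⟩
    exact ⟨q, hq, -k, by rw [mul_neg, hk, Int.cast_neg]⟩

variable {N : ℕ}

theorem dvd_of_div_mem_coprimeFractions (hN : N ≠ 0) {a : ℤ}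
    (h : (a : ℝ) / N ∈ coprimeFractions N) : (N : ℤ) ∣ a := by
  obtain ⟨q, hq, k, hk⟩ := h
  refine (Nat.isCoprime_iff_coprime.2 hq).dvd_of_dvd_mul_left ⟨k, ?_⟩
  rw [← mul_div_assoc, div_eq_iff (Nat.cast_ne_zero.2 hN), mul_comm (k : ℝ)] at hk
  exact_mod_cast hk

theorem mem_coprimeFractions_of_ifsMap_mem (hN : N ≠ 0) {ℓ : ℤ} {x : ℝ}
    (h : ifsMap N ℓ x ∈ coprimeFractions N) : x ∈ coprimeFractions N := by
  have hx : x = N • ifsMap N ℓ x - ((ℓ : ℤ) : ℝ) := by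
    rw [nsmul_eq_mul, ifsMap, mul_div_cancel₀ _ (Nat.cast_ne_zero.2 hN), add_sub_cancel_right]
  rw [hx]
  exact sub_mem (nsmul_mem h N) ⟨1, Nat.coprime_one_right N, ℓ, by simp⟩

theorem pow_mul_iterate_eq (hN : N ≠ 0) {g : ℝ → ℝ} (hg : ∀ x, ∃ ℓ : ℤ, g x = ifsMap N ℓ x)
    (n : ℕ) (y : ℝ) : ∃ k : ℤ, (N : ℝ) ^ n * g^[n] y = y + k := by
  induction n with
  | zero => exact ⟨0, by simp⟩
  | succ n ih =>
    obtain ⟨k, hk⟩ := ih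
    obtain ⟨ℓ, hℓ⟩ := hg (g^[n] y)
    refine ⟨k + N ^ n * ℓ, ?_⟩
    rw [Function.iterate_succ_apply', hℓ, ifsMap, pow_succ, mul_assoc,
      mul_div_cancel₀ _ (Nat.cast_ne_zero.2 hN), mul_add, hk]
    push_cast
    ring

theorem mem_coprimeFractions_of_mem_periodicPts (hN : N ≠ 0) {g : ℝ → ℝ}
    (hg : ∀ x, ∃ ℓ : ℤ, g x = ifsMap N ℓ x) {y : ℝ} (hy : y ∈ Function.periodicPts g) :
    y ∈ coprimeFractions N := by
  obtain ⟨n, hn, hper⟩ := hy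
  obtain ⟨k, hk⟩ := pow_mul_iterate_eq hN hg n y
  have hpos : 1 ≤ N ^ n := Nat.one_le_pow n N (Nat.pos_of_ne_zero hN)
  refine ⟨N ^ n - 1, ?_, k, ?_⟩
  · exact ((Nat.coprime_self_sub_right hpos).2 (Nat.coprime_one_right _)).coprime_dvd_left
      (dvd_pow_self N hn.ne')
  · rw [hper] at hk
    rw [Nat.cast_sub hpos]
    push_cast
    linear_combination hk

theorem exists_iterate_mem_periodicPts {α : Type*} {Z : Set α} (hZ : Z.Finite) {g : α → α}
    (hg : Set.MapsTo g Z Z) {x : α} (hx : x ∈ Z) : ∃ i, g^[i] x ∈ Function.periodicPts g := by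
  obtain ⟨i, -, j, -, hij, h⟩ := Set.infinite_univ.exists_lt_map_eq_of_mapsTo
    (f := fun i : ℕ ↦ g^[i] x) (fun i _ ↦ hg.iterate i hx) hZ
  refine ⟨i, j - i, Nat.sub_pos_of_lt hij, ?_⟩
  rw [Function.IsPeriodicPt, Function.IsFixedPt, ← Function.iterate_add_apply,
    Nat.sub_add_cancel hij.le]
  exact h.symm

theorem subset_coprimeFractions (hN : N ≠ 0) {g : ℝ → ℝ} (hg : ∀ x, ∃ ℓ : ℤ, g x = ifsMap N ℓ x)
    {Z : Set ℝ} (hZ : Z.Finite) (hgZ : Set.MapsTo g Z Z) : Z ⊆ coprimeFractions N := by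
  intro x hx
  obtain ⟨i, hi⟩ := exists_iterate_mem_periodicPts hZ hgZ hx
  replace hi := mem_coprimeFractions_of_mem_periodicPts hN hg hi
  induction i with
  | zero => exact hi
  | succ i ih =>
    rw [Function.iterate_succ_apply'] at hi
    obtain ⟨ℓ, hℓ⟩ := hg (g^[i] x)
    exact ih (mem_coprimeFractions_of_ifsMap_mem hN (hℓ ▸ hi))

end CoprimeFractions

section TransferOperator

variable {N : ℕ} {B L : Finset ℤ}

/-- `Z` is invariant under all branches `τ_ℓ` that have positive probability `|m_B(τ_ℓ x)|²` in the
random walk whose transition operator is the transfer operator of `(N, B, L)`. -/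
def IsMaskInvariant (N : ℕ) (B L : Finset ℤ) (Z : Set ℝ) : Prop :=
  ∀ x ∈ Z, ∀ ℓ ∈ L, maskFunction B (ifsMap N ℓ x) ≠ 0 → ifsMap N ℓ x ∈ Z

theorem isCycle_of_isPeriodicPt {l : ℝ → ℤ} (hl : ∀ x, l x ∈ L) {n : ℕ} {y : ℝ}
    (hy : Function.IsPeriodicPt (fun x ↦ ifsMap N (l x) x) (n + 1) y) :
    IsCycle N L (Set.range fun j : Fin (n + 1) ↦ (fun x ↦ ifsMap N (l x) x)^[j] y) := by
  refine ⟨n, _, fun j ↦ l ((fun x ↦ ifsMap N (l x) x)^[j] y), rfl, fun j ↦ hl _, fun j ↦ ?_⟩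
  rw [Fin.val_add_one]
  split_ifs with hj
  · rw [hj, Fin.val_last, Function.iterate_zero_apply]
    exact (Function.iterate_succ_apply' _ n y).symm.trans hy
  · exact (Function.iterate_succ_apply' (fun x ↦ ifsMap N (l x) x) _ y).symm

namespace IsHadamardTriple

variable (h : IsHadamardTriple N B L)
include h

theorem exists_maskFunction_ifsMap_ne_zero (x : ℝ) :
    ∃ ℓ ∈ L, maskFunction B (ifsMap N ℓ x) ≠ 0 := by
  obtain ⟨ℓ, hℓ, hne⟩ := Finset.exists_ne_zero_of_sum_ne_zero
    ((h.sum_norm_maskFunction_ifsMap_sq x).trans_ne one_ne_zero)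
  exact ⟨ℓ, hℓ, fun h0 ↦ hne (by rw [h0, norm_zero, sq, mul_zero])⟩

theorem norm_maskFunction_ifsMap_eq_one {x : ℝ}
    (hx : ∀ ℓ ∈ L, maskFunction B (ifsMap N ℓ x) ≠ 0 → ifsMap N ℓ x ∈ coprimeFractions N)
    {ℓ : ℤ} (hℓ : ℓ ∈ L) (hne : maskFunction B (ifsMap N ℓ x) ≠ 0) :
    ‖maskFunction B (ifsMap N ℓ x)‖ = 1 := by
  have hsum := h.sum_norm_maskFunction_ifsMap_sq x
  rw [Finset.sum_eq_single_of_mem ℓ hℓ] at hsum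
  · exact (pow_eq_one_iff_of_nonneg (norm_nonneg _) two_ne_zero).1 hsum
  intro ℓ' hℓ' hℓℓ'
  by_contra h0
  have hne' : maskFunction B (ifsMap N ℓ' x) ≠ 0 :=
    fun h1 ↦ h0 (by rw [h1, norm_zero, sq, mul_zero])
  refine hℓℓ' (h.eq_of_dvd_sub hℓ' hℓ
    (dvd_of_div_mem_coprimeFractions (two_pos.trans_le h.two_le).ne' ?_))
  convert sub_mem (hx ℓ' hℓ' hne') (hx ℓ hℓ hne) using 1
  rw [ifsMap, ifsMap]
  push_cast
  ring

theorem exists_isExtremeCycle_subset {Z : Set ℝ} (hinv : IsMaskInvariant N B L Z) (hfin : Z.Finite)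
    (hne : Z.Nonempty) : ∃ C, IsExtremeCycle N B L C ∧ (C ∩ Z).Nonempty := by
  choose l hlL hl0 using h.exists_maskFunction_ifsMap_ne_zero
  set g : ℝ → ℝ := fun x ↦ ifsMap N (l x) x
  have hgZ : Set.MapsTo g Z Z := fun x hx ↦ hinv x hx _ (hlL x) (hl0 x)
  have hZ : Z ⊆ coprimeFractions N :=
    subset_coprimeFractions (two_pos.trans_le h.two_le).ne' (fun x ↦ ⟨l x, rfl⟩) hfin hgZ
  have hmask : ∀ x ∈ Z, ‖maskFunction B (g x)‖ = 1 := fun x hx ↦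
    h.norm_maskFunction_ifsMap_eq_one (fun ℓ hℓ h0 ↦ hZ (hinv x hx ℓ hℓ h0)) (hlL x) (hl0 x)
  obtain ⟨x, hx⟩ := hne
  obtain ⟨i, n, hn, hper⟩ := exists_iterate_mem_periodicPts hfin hgZ hx
  obtain ⟨q, rfl⟩ := Nat.exists_eq_add_one_of_ne_zero hn.ne'
  have hyZ : g^[i] x ∈ Z := hgZ.iterate i hx
  refine ⟨_, ⟨isCycle_of_isPeriodicPt hlL hper, ?_⟩, g^[i] x, ⟨0, rfl⟩, hyZ⟩
  rintro _ ⟨j, rfl⟩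
  have hj : g^[j] (g^[i] x) = g (g^[(j : ℕ) + q] (g^[i] x)) := by
    rw [← Function.iterate_succ_apply' g, Nat.succ_eq_add_one, add_assoc,
      Function.iterate_add_apply, hper]
  exact (congrArg (‖maskFunction B ·‖) hj).trans (hmask _ (hgZ.iterate _ hyZ))

theorem isMaskInvariant_level {Q : ℝ → ℝ} {J : Set ℝ} {m : ℝ}
    (hJ : ∀ ℓ ∈ L, Set.MapsTo (ifsMap N ℓ) J J) (hm : ∀ x ∈ J, m ≤ Q x)
    (hQ : ∀ x, Q x = ∑ ℓ ∈ L, ‖maskFunction B (ifsMap N ℓ x)‖ ^ 2 * Q (ifsMap N ℓ x)) :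
    IsMaskInvariant N B L {x ∈ J | Q x = m} := by
  rintro x ⟨hx, hxm⟩ ℓ hℓ hne
  refine ⟨hJ ℓ hℓ hx, ?_⟩
  have hsum : ∑ ℓ ∈ L, ‖maskFunction B (ifsMap N ℓ x)‖ ^ 2 * (Q (ifsMap N ℓ x) - m) = 0 := by
    simp only [mul_sub, Finset.sum_sub_distrib]
    rw [← hQ x, ← Finset.sum_mul, h.sum_norm_maskFunction_ifsMap_sq, hxm, one_mul, sub_self]
  have hzero := (Finset.sum_eq_zero_iff_of_nonneg fun ℓ hℓ ↦
    mul_nonneg (sq_nonneg _) (sub_nonneg.2 (hm _ (hJ ℓ hℓ hx)))).1 hsum ℓ hℓ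
  exact sub_eq_zero.1 ((mul_eq_zero.1 hzero).resolve_left (pow_ne_zero 2 (norm_ne_zero_iff.2 hne)))

end IsHadamardTriple

theorem exists_mapsTo_ifsMap_Icc (hN : 2 ≤ N) (L : Finset ℤ) :
    ∃ R > 0, ∀ ℓ ∈ L, Set.MapsTo (ifsMap N ℓ) (Set.Icc (-R) R) (Set.Icc (-R) R) := by
  obtain ⟨R, hR, hL⟩ := digit_bound L
  have hN2 : (2 : ℝ) ≤ N := by exact_mod_cast hN
  refine ⟨R + 1, by linarith, fun ℓ hℓ x hx ↦ ?_⟩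
  rw [Set.mem_Icc, ← abs_le] at hx ⊢
  rw [ifsMap, abs_div, Nat.abs_cast, div_le_iff₀ (by linarith)]
  calc |x + ℓ| ≤ |x| + |(ℓ : ℝ)| := abs_add_le _ _
    _ ≤ (R + 1) + (R + 1) := by linarith [hL ℓ hℓ]
    _ ≤ (R + 1) * N := by nlinarith

theorem eq_of_infinite_level {E : Type*} [NormedAddCommGroup E] [NormedSpace ℝ E] {f : ℝ → E}
    (hf : AnalyticOnNhd ℝ f Set.univ) {K : Set ℝ} (hK : IsCompact K) {c : E}
    (h : {x ∈ K | f x = c}.Infinite) (x : ℝ) : f x = c := by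
  obtain ⟨z, -, hz⟩ := h.exists_accPt_of_subset_isCompact hK (Set.sep_subset _ _)
  have hfreq : ∃ᶠ y in 𝓝[≠] z, f y = c :=
    (accPt_iff_frequently_nhdsNE.1 hz).mono fun y hy ↦ hy.2
  exact hf.eqOn_of_preconnected_of_frequently_eq analyticOnNhd_const isPreconnected_univ
    (Set.mem_univ z) hfreq (Set.mem_univ x)

theorem IsHadamardTriple.eq_one_of_transfer (h : IsHadamardTriple N B L) {Q : ℝ → ℝ}
    (hQ : ContDiff ℝ ω Q) (hle : ∀ x, Q x ≤ 1) (h0 : Q 0 = 1)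
    (htr : ∀ x, Q x = ∑ ℓ ∈ L, ‖maskFunction B (ifsMap N ℓ x)‖ ^ 2 * Q (ifsMap N ℓ x))
    (hC : ∀ C, IsExtremeCycle N B L C → ∀ x ∈ C, Q x = 1) (x : ℝ) : Q x = 1 := by
  obtain ⟨R, hR, hJ⟩ := exists_mapsTo_ifsMap_Icc h.two_le L
  obtain ⟨x₀, hx₀, hmin⟩ := isCompact_Icc.exists_isMinOn
    (Set.nonempty_Icc.2 (neg_le_self hR.le)) hQ.continuous.continuousOn
  have hconst {c : ℝ} (hc : {x ∈ Set.Icc (-R) R | Q x = c}.Infinite) (x : ℝ) : Q x = c :=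
    eq_of_infinite_level (contDiff_omega_iff_analyticOnNhd.1 hQ) isCompact_Icc hc x
  have hx₀1 : Q x₀ = 1 := by
    rcases {x ∈ Set.Icc (-R) R | Q x = Q x₀}.finite_or_infinite with hfin | hinf
    · obtain ⟨C, hext, y, hyC, hy⟩ := h.exists_isExtremeCycle_subset
        (h.isMaskInvariant_level hJ (fun x hx ↦ hmin hx) htr) hfin ⟨x₀, hx₀, rfl⟩
      rw [← hy.2, hC C hext y hyC]
    · rw [← h0, hconst hinf 0]
  refine hconst ((Set.Icc_infinite (neg_lt_self hR)).mono fun y hy ↦ ⟨hy, ?_⟩) x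
  exact (hle y).antisymm (hx₀1.ge.trans (hmin hy))

end TransferOperator

section SpectralPair

variable {N : ℕ} {B L : Finset ℤ}

theorem ae_abs_le_selfSimilarMeasure (hN : 2 ≤ N) (hB : B.Nonempty) :
    ∃ R : ℝ, ∀ᵐ x ∂(selfSimilarMeasure N B), |x| ≤ R := by
  obtain ⟨R, hR⟩ := (selfSimilarSet_spec hN hB).2.1.isBounded.exists_norm_le
  refine ⟨R, ?_⟩
  rw [selfSimilarMeasure, ae_map_iff (continuous_digitSum hN B).measurable.aemeasurable
    (measurableSet_le (by fun_prop) (by fun_prop))]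
  exact .of_forall fun a ↦ hR _ ⟨a, rfl⟩

namespace IsHadamardTriple

theorem eq_transfer (h : IsHadamardTriple N B L) (h0 : 0 ∈ B) {Q : ℝ → ℝ}
    (hQ : ∀ x, HasSum (fun s : canonicalSpectrum N B L ↦
      ‖fourierStieltjes (selfSimilarMeasure N B) (x + s)‖ ^ 2) (Q x)) (x : ℝ) :
    Q x = ∑ ℓ ∈ L, ‖maskFunction B (ifsMap N ℓ x)‖ ^ 2 * Q (ifsMap N ℓ x) := by
  have hN := h.cast_pos
  have hfiber (ℓ : L) : HasSum (fun s : canonicalSpectrum N B L ↦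
      ‖fourierStieltjes (selfSimilarMeasure N B) (x + (N * s + ((ℓ : ℤ) : ℝ)))‖ ^ 2)
      (‖maskFunction B (ifsMap N ℓ x)‖ ^ 2 * Q (ifsMap N ℓ x)) := by
    refine ((hQ (ifsMap N ℓ x)).mul_left (‖maskFunction B (ifsMap N ℓ x)‖ ^ 2)).congr_fun
      fun s ↦ ?_
    have hdiv : (x + (N * (s : ℝ) + ((ℓ : ℤ) : ℝ))) / N = ifsMap N ℓ x + s := by
      rw [ifsMap]
      field_simp
      ring
    rw [fourierStieltjes_selfSimilarMeasure h.two_le h.nonempty, hdiv,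
      maskFunction_add (canonicalSpectrum_subset_dualLattice h0 s.2), norm_mul, mul_pow]
  have hsum := ((Equiv.ofBijective _ (h.bijective_mul_add_canonicalSpectrum h0)).hasSum_iff.2
    (hQ x)).prod_fiberwise hfiber
  rw [← Finset.sum_coe_sort L]
  exact hsum.unique (hasSum_fintype _)

theorem isSpectralPair (h : IsHadamardTriple N B L) (hB : 0 ∈ B) (hL : 0 ∈ L) :
    IsSpectralPair (selfSimilarMeasure N B) (canonicalSpectrum N B L) := by
  have := (selfSimilarMeasure_spec h.two_le h.nonempty).1
  have hsub := canonicalSpectrum_subset_dualLattice (N := N) (L := L) hB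
  have horth := h.fourierStieltjes_eq_zero hsub fun x hx ↦
    exists_eq_mul_add_of_mem_canonicalSpectrum (two_pos.trans_le h.two_le).ne' hx
  obtain ⟨R, hR⟩ := ae_abs_le_selfSimilarMeasure h.two_le h.nonempty
  obtain ⟨Q, hQ, hle, hsum⟩ := exists_contDiff_hasSum hR horth
  have hcycle : ∀ C, IsExtremeCycle N B L C → ∀ x ∈ C, Q x = 1 := fun C hC x hx ↦ by
    refine (hle x).antisymm ?_
    simpa [fourierStieltjes_zero] using
      le_hasSum (hsum x) ⟨-x, neg_mem_canonicalSpectrum hC hx⟩ fun _ _ ↦ sq_nonneg _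
  have hQ0 : Q 0 = 1 := hcycle _ (isExtremeCycle_zero h.nonempty hL) 0 rfl
  have hQ1 := h.eq_one_of_transfer hQ hle hQ0 (h.eq_transfer hB hsum) hcycle
  exact isSpectralPair_of_hasSum ((countable_dualLattice h.exists_mem_ne_zero).mono hsub) horth
    fun x ↦ hQ1 x ▸ hsum x

end IsHadamardTriple
end SpectralPair

section Scaling

theorem pow_toNat_emod_eq_zpow {K : Type*} [Field K] {η : K} {N : ℕ} (hN : N ≠ 0) (hη : η ^ N = 1)
    (j : ℤ) : η ^ (j % N).toNat = η ^ j := by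
  have h0 : η ≠ 0 := by
    rintro rfl
    exact zero_ne_one ((zero_pow hN).symm.trans hη)
  rw [← zpow_natCast, Int.toNat_of_nonneg (Int.emod_nonneg _ (Int.natCast_ne_zero.2 hN)),
    Int.emod_def, zpow_sub₀ h0, zpow_mul, zpow_natCast, hη, one_zpow, div_one]

/-- `ζ` and `ζ ^ p` have the same minimal polynomial over `ℤ`. -/
theorem sum_pow_zpow_eq_zero {K ι : Type*} [Field K] [CharZero K] {N p : ℕ} (hN : N ≠ 0)
    (hp : p.Coprime N) {ζ : K} (hζ : IsPrimitiveRoot ζ N) {s : Finset ι} {e : ι → ℤ}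
    (h : ∑ i ∈ s, ζ ^ e i = 0) : ∑ i ∈ s, (ζ ^ p) ^ e i = 0 := by
  let f : Polynomial ℤ := ∑ i ∈ s, Polynomial.X ^ (e i % N).toNat
  have hf {η : K} (hη : η ^ N = 1) : Polynomial.aeval η f = ∑ i ∈ s, η ^ e i := by
    simp only [f, map_sum, map_pow, Polynomial.aeval_X, pow_toNat_emod_eq_zpow hN hη]
  have hdvd : minpoly ℤ ζ ∣ f :=
    minpoly.isIntegrallyClosed_dvd (hζ.isIntegral (Nat.pos_of_ne_zero hN))
      ((hf hζ.pow_eq_one).trans h)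
  rw [hζ.minpoly_eq_pow_coprime hp] at hdvd
  rw [← hf (by rw [pow_right_comm, hζ.pow_eq_one, one_pow])]
  exact Polynomial.aeval_eq_zero_of_dvd_aeval_eq_zero hdvd (minpoly.aeval _ _)

variable {N : ℕ} {B L : Finset ℤ}

theorem maskFunction_int_div (k : ℤ) : maskFunction B (k / N) =
    (1 / (B.card : ℂ)) * ∑ b ∈ B, Complex.exp (2 * π * Complex.I / N) ^ (b * k) := by
  rw [maskFunction]
  refine congrArg _ (Finset.sum_congr rfl fun b _ ↦ ?_)
  rw [← Complex.exp_int_mul]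
  push_cast
  ring_nf

theorem maskFunction_mul_int_div_eq_zero {p : ℕ} (hN : N ≠ 0) (hp : p.Coprime N) {k : ℤ}
    (h : maskFunction B (k / N) = 0) : maskFunction B ((p * k : ℤ) / N) = 0 := by
  rw [maskFunction_int_div, mul_eq_zero] at h ⊢
  refine h.imp_right fun hsum ↦ ?_
  rw [← sum_pow_zpow_eq_zero hN hp (Complex.isPrimitiveRoot_exp N hN) hsum]
  refine Finset.sum_congr rfl fun b _ ↦ ?_
  rw [← zpow_natCast _ p, ← zpow_mul, mul_left_comm]

theorem IsHadamardTriple.image_mul {p : ℕ} (h : IsHadamardTriple N B L) (hp : p.Coprime N) :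
    IsHadamardTriple N B (L.image (p * ·)) := by
  have hp0 : (p : ℤ) ≠ 0 := by
    rintro hp0
    obtain rfl := Int.natCast_eq_zero.1 hp0
    exact absurd ((Nat.coprime_zero_left N).1 hp) (Nat.lt_of_succ_le h.two_le).ne'
  refine isHadamardTriple_iff.2 ⟨h.two_le, h.two_le_card, ?_, ?_⟩
  · rw [Finset.card_image_of_injective _ (mul_right_injective₀ hp0), h.card_eq]
  · simp only [Finset.forall_mem_image]
    intro ℓ hℓ ℓ' hℓ' hne
    have h0 := h.maskFunction_sub_div_eq_zero hℓ hℓ' (ne_of_apply_ne _ hne)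
    rw [← Int.cast_sub] at h0 ⊢
    rw [← mul_sub]
    exact maskFunction_mul_int_div_eq_zero (two_pos.trans_le h.two_le).ne' hp h0

theorem ifsMap_mul (c ℓ : ℤ) (x : ℝ) : ifsMap N (c * ℓ) (c * x) = c * ifsMap N ℓ x := by
  rw [ifsMap, ifsMap]
  push_cast
  ring

theorem isCycle_image_mul_iff {c : ℤ} (hc : c ≠ 0) {C : Set ℝ} :
    IsCycle N (L.image (c * ·)) C ↔ ∃ C', IsCycle N L C' ∧ ((c : ℝ) * ·) '' C' = C := by
  have hc' : (c : ℝ) ≠ 0 := Int.cast_ne_zero.2 hc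
  constructor
  · rintro ⟨k, y, ℓ, rfl, hℓ, hy⟩
    choose a ha hℓa using fun j ↦ Finset.mem_image.1 (hℓ j)
    have hcy (j) : (c : ℝ) * (y j / c) = y j := mul_div_cancel₀ _ hc'
    refine ⟨_, ⟨k, fun j ↦ y j / c, a, rfl, ha, fun j ↦ mul_left_cancel₀ hc' ?_⟩, ?_⟩
    · rw [← ifsMap_mul, hcy, hcy, hℓa, hy]
    · rw [← Set.range_comp]
      exact congrArg Set.range (funext hcy)
  · rintro ⟨_, ⟨k, y, ℓ, rfl, hℓ, hy⟩, rfl⟩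
    refine ⟨k, fun j ↦ c * y j, fun j ↦ c * ℓ j, (Set.range_comp _ _).symm,
      fun j ↦ Finset.mem_image_of_mem _ (hℓ j), fun j ↦ ?_⟩
    rw [ifsMap_mul, hy]

theorem isExtremeCycle_iff (h0 : 0 ∈ B) {C : Set ℝ} :
    IsExtremeCycle N B L C ↔ IsCycle N L C ∧ C ⊆ dualLattice B :=
  and_congr_right' (forall₂_congr fun _ _ ↦ norm_maskFunction_eq_one_iff h0)

theorem canonicalSpectrum_image_mul {c : ℤ} (hc : c ≠ 0) (h0 : 0 ∈ B)
    (hC : ∀ C, IsCycle N L C → ((c : ℝ) * ·) '' C ⊆ dualLattice B → C ⊆ dualLattice B) :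
    canonicalSpectrum N B (L.image (c * ·)) = ((c : ℝ) * ·) '' canonicalSpectrum N B L := by
  apply subset_antisymm
  · refine canonicalSpectrum_subset (fun C' hC' ↦ ?_) ?_
    · obtain ⟨hcyc, hsub⟩ := (isExtremeCycle_iff h0).1 hC'
      obtain ⟨C, hcycC, rfl⟩ := (isCycle_image_mul_iff hc).1 hcyc
      have hext : IsExtremeCycle N B L C := (isExtremeCycle_iff h0).2 ⟨hcycC, hC C hcycC hsub⟩
      rintro _ ⟨x, hx, rfl⟩
      exact ⟨-x, neg_mem_canonicalSpectrum hext hx, mul_neg _ _⟩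
    · rintro _ ⟨x, hx, rfl⟩ _ hm
      obtain ⟨ℓ, hℓ, rfl⟩ := Finset.mem_image.1 hm
      refine ⟨_, mul_add_mem_canonicalSpectrum hx hℓ, ?_⟩
      push_cast
      ring
  · rw [Set.image_subset_iff]
    refine canonicalSpectrum_subset (fun C hC x hx ↦ ?_) fun x hx ℓ hℓ ↦ ?_
    · obtain ⟨hcyc, hsub⟩ := (isExtremeCycle_iff h0).1 hC
      have hext : IsExtremeCycle N B (L.image (c * ·)) (((c : ℝ) * ·) '' C) := by
        refine (isExtremeCycle_iff h0).2 ⟨(isCycle_image_mul_iff hc).2 ⟨C, hcyc, rfl⟩, ?_⟩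
        rintro _ ⟨y, hy, rfl⟩
        simpa only [SetLike.mem_coe, zsmul_eq_mul] using zsmul_mem (hsub hy) c
      rw [Set.mem_preimage, mul_neg]
      exact neg_mem_canonicalSpectrum hext ⟨x, hx, rfl⟩
    · have hmem := mul_add_mem_canonicalSpectrum hx (Finset.mem_image_of_mem (c * ·) hℓ)
      push_cast at hmem
      rwa [mul_left_comm, ← mul_add] at hmem

end Scaling

section Orbits

variable {N : ℕ} {B L : Finset ℤ} {C : Set ℝ}

theorem exists_gcd_mul_eq_of_mem_dualLattice {x : ℝ} (hx : x ∈ dualLattice B) :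
    ∃ k : ℤ, ((B.gcd Int.natAbs : ℕ) : ℝ) * x = k := by
  let H : AddSubgroup ℤ :=
    (Int.castAddHom ℝ).range.comap ((AddMonoidHom.mulRight x).comp (Int.castAddHom ℝ))
  obtain ⟨g, hg⟩ := Int.subgroup_cyclic H
  rw [← AddSubgroup.zmultiples_eq_closure] at hg
  have hBH : ∀ b ∈ B, b ∈ H := fun b hb ↦ (mem_dualLattice.1 hx b hb).imp fun _ h ↦ h.symm
  have hgcd : ((B.gcd Int.natAbs : ℕ) : ℤ) ∈ H := by
    simp only [hg, Int.mem_zmultiples_iff] at hBH ⊢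
    exact Int.dvd_natCast.2 (Finset.dvd_gcd fun b hb ↦ Int.natAbs_dvd_natAbs.2 (hBH b hb))
  obtain ⟨k, hk⟩ := hgcd
  exact ⟨k, hk.symm⟩

theorem IsCycle.finite (hC : IsCycle N L C) : C.Finite := by
  obtain ⟨k, x, -, rfl, -⟩ := hC
  exact Set.finite_range x

theorem IsCycle.subset_iUnion_image (hC : IsCycle N L C) : C ⊆ ⋃ ℓ ∈ L, ifsMap N ℓ '' C := by
  obtain ⟨k, x, ℓ, rfl, hℓ, hx⟩ := hC
  rintro _ ⟨j, rfl⟩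
  refine Set.mem_biUnion (hℓ (j - 1)) ⟨x (j - 1), ⟨_, rfl⟩, ?_⟩
  rw [hx, sub_add_cancel]

theorem subset_selfSimilarSet (hN : 2 ≤ N) (hbdd : Bornology.IsBounded C)
    (hC : C ⊆ ⋃ ℓ ∈ L, ifsMap N ℓ '' C) : C ⊆ selfSimilarSet N L := by
  have hpred (x : C) : ∃ y : C, ∃ ℓ : L, ifsMap N ℓ y = x := by
    obtain ⟨ℓ, hℓ, y, hy, hyx⟩ := Set.mem_iUnion₂.1 (hC x.2)
    exact ⟨⟨y, hy⟩, ⟨ℓ, hℓ⟩, hyx⟩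
  choose g ℓ hg using hpred
  intro x hx
  obtain ⟨R, hR⟩ := hbdd.exists_norm_le
  obtain ⟨S, hS⟩ := (selfSimilarSet_spec hN ⟨_, (ℓ ⟨x, hx⟩).2⟩).2.1.isBounded.exists_norm_le
  have hexpand := abs_digitSum_sub_le hN (fun n ↦ (g^[n] ⟨x, hx⟩ : ℝ))
    (fun n ↦ ℓ (g^[n] ⟨x, hx⟩)) fun n ↦ by rw [Function.iterate_succ_apply', hg]
  have hle (n : ℕ) : |x - digitSum N L fun n ↦ ℓ (g^[n] ⟨x, hx⟩)| ≤ (R + S) / (N : ℝ) ^ n := by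
    refine (congrArg abs (hexpand n)).trans_le ?_
    rw [abs_div, abs_of_nonneg (by positivity : (0 : ℝ) ≤ (N : ℝ) ^ n)]
    gcongr
    exact (abs_sub _ _).trans (add_le_add (hR _ (g^[n] ⟨x, hx⟩).2) (hS _ ⟨_, rfl⟩))
  have hzero := abs_nonpos_iff.1 (ge_of_tendsto' (tendsto_div_pow hN (R + S)) hle)
  exact ⟨_, (sub_eq_zero.1 hzero).symm⟩

/-- The integers `b p x`, `x ∈ C`, get multiplied by `N` modulo `p` along backward orbits. -/
theorem orderOf_le_ncard {p : ℕ} (hN : N ≠ 0) (hp : p.Prime) (hfin : C.Finite)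
    (hC : C ⊆ ⋃ ℓ ∈ L, ifsMap N ℓ '' C) (hpC : ((p : ℝ) * ·) '' C ⊆ dualLattice B)
    (hnot : ¬ C ⊆ dualLattice B) : orderOf (N : ZMod p) ≤ C.ncard := by
  have := Fact.mk hp
  have hp0 : (p : ℝ) ≠ 0 := Nat.cast_ne_zero.2 hp.ne_zero
  obtain ⟨x, hx, hxB⟩ := Set.not_subset.1 hnot
  simp only [SetLike.mem_coe, mem_dualLattice, not_forall] at hxB
  obtain ⟨b, hb, hbx⟩ := hxB
  choose a ha using fun y : C ↦ mem_dualLattice.1 (hpC ⟨y, y.2, rfl⟩) b hb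
  have hpred (y : C) : ∃ z : C, (a z : ZMod p) = N * a y := by
    obtain ⟨ℓ, -, z, hz, hzy⟩ := Set.mem_iUnion₂.1 (hC y.2)
    have heq : a ⟨z, hz⟩ = N * a y - p * (b * ℓ) := by
      rw [← Int.cast_inj (α := ℝ)]
      push_cast
      rw [← ha, ← ha, ← hzy, ifsMap]
      field_simp
      ring
    exact ⟨⟨z, hz⟩, by simp [heq]⟩
  choose g hg using hpred
  have horbit (n : ℕ) : (a (g^[n] ⟨x, hx⟩) : ZMod p) = N ^ n * a ⟨x, hx⟩ := by
    induction n with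
    | zero => rw [Function.iterate_zero_apply, pow_zero, one_mul]
    | succ n ih => rw [Function.iterate_succ_apply', hg, ih, pow_succ', mul_assoc]
  have hax : (a ⟨x, hx⟩ : ZMod p) ≠ 0 := fun h0 ↦ by
    obtain ⟨c, hc⟩ := (ZMod.intCast_zmod_eq_zero_iff_dvd _ p).1 h0
    refine hbx ⟨c, mul_left_cancel₀ hp0 ?_⟩
    rw [mul_left_comm, ha ⟨x, hx⟩, hc, Int.cast_mul, Int.cast_natCast]
  have hinj : Set.InjOn (fun n ↦ (g^[n] ⟨x, hx⟩ : ℝ)) (Set.Iio (orderOf (N : ZMod p))) :=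
    fun m hm n hn hmn ↦ pow_injOn_Iio_orderOf hm hn <| mul_right_cancel₀ hax <| by
      rw [← horbit, ← horbit, Subtype.ext hmn]
  have hmaps : Set.MapsTo (fun n ↦ (g^[n] ⟨x, hx⟩ : ℝ)) (Set.Iio (orderOf (N : ZMod p))) C :=
    fun n _ ↦ (g^[n] ⟨x, hx⟩).2
  simpa using Set.ncard_le_ncard_of_injOn _ hmaps hinj hfin

end Orbits

section HausdorffDimension

open scoped NNReal ENNReal

theorem measure_le_mul_ediam_rpow {X : Type*} [PseudoMetricSpace X] [MeasurableSpace X]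
    {μ : Measure X} {M : ℝ≥0∞} (hM : M ≠ ⊤) {s : ℝ≥0}
    (hμ : ∀ x, ∀ r ∈ Set.Ioo (0 : ℝ) 1, μ (Metric.closedBall x r) ≤ M * ENNReal.ofReal r ^ (s : ℝ))
    {E : Set X} (hE : Metric.ediam E < 1) : μ E ≤ M * Metric.ediam E ^ (s : ℝ) := by
  obtain rfl | ⟨x, hx⟩ := E.eq_empty_or_nonempty
  · simp only [measure_empty, zero_le]
  lift Metric.ediam E to ℝ≥0 using hE.ne_top with D hD
  have hD1 : (D : ℝ) < 1 := by exact_mod_cast hE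
  have hlim : Tendsto (fun r : ℝ ↦ M * ENNReal.ofReal r ^ (s : ℝ)) (𝓝[>] (D : ℝ))
      (𝓝 (M * D ^ (s : ℝ))) := by
    refine ENNReal.Tendsto.const_mul (tendsto_nhdsWithin_of_tendsto_nhds ?_) (.inr hM)
    have hcont : Continuous fun r : ℝ ↦ ENNReal.ofReal r ^ (s : ℝ) :=
      ENNReal.continuous_rpow_const.comp ENNReal.continuous_ofReal
    simpa only [ENNReal.ofReal_coe_nnreal] using hcont.tendsto D
  refine ge_of_tendsto hlim ?_
  filter_upwards [Ioo_mem_nhdsGT hD1] with r hr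
  have hr0 : 0 < r := D.coe_nonneg.trans_lt hr.1
  refine (measure_mono fun y hy ↦ ?_).trans (hμ x r ⟨hr0, hr.2⟩)
  rw [Metric.mem_closedBall, ← edist_le_ofReal hr0.le]
  exact (Metric.edist_le_ediam_of_mem hy hx).trans
    (hD ▸ ENNReal.ofReal_coe_nnreal (p := D) ▸ ENNReal.ofReal_le_ofReal hr.1.le)

/-- The mass distribution principle. -/
theorem le_dimH_of_measure_closedBall_le {X : Type*} [MetricSpace X] [MeasurableSpace X]
    [BorelSpace X] {μ : Measure X} {M : ℝ≥0∞} (hM : M ≠ ⊤) {s : ℝ≥0}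
    (hμ : ∀ x, ∀ r ∈ Set.Ioo (0 : ℝ) 1,
      μ (Metric.closedBall x r) ≤ M * ENNReal.ofReal r ^ (s : ℝ)) {K : Set X} (hK : μ K ≠ 0) :
    (s : ℝ≥0∞) ≤ dimH K := by
  have hM0 : M + 1 ≠ 0 := by simp
  have hMtop : M + 1 ≠ ⊤ := by simp [hM]
  have hle : (M + 1)⁻¹ • μ ≤ Measure.hausdorffMeasure (s : ℝ) := by
    refine Measure.le_hausdorffMeasure _ _ 2⁻¹ (by simp) fun E hE ↦ ?_
    rw [Measure.smul_apply, smul_eq_mul, ENNReal.inv_mul_le_iff hM0 hMtop]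
    refine (measure_le_mul_ediam_rpow hM hμ (hE.trans_lt ENNReal.one_half_lt_one)).trans ?_
    gcongr
    exact le_self_add
  refine le_dimH_of_hausdorffMeasure_ne_zero fun h0 ↦ hK ?_
  have hK0 := (hle K).trans_eq h0
  rwa [Measure.smul_apply, smul_eq_mul, nonpos_iff_eq_zero, mul_eq_zero,
    or_iff_right (ENNReal.inv_ne_zero.2 hMtop)] at hK0

end HausdorffDimension

section Digits

variable {N : ℕ} {A : Finset ℤ}

/-- The integer `∑_{k < n} c_k N^{n-1-k}` whose base-`N` digits, from the leading one, are
`c_0, …, c_{n-1}`; it is the integral part of `N ^ n * digitSum N A c` up to a bounded error. -/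
def digitPrefix (N : ℕ) {A : Finset ℤ} (c : ℕ → A) : ℕ → ℤ
  | 0 => 0
  | n + 1 => N * digitPrefix N c n + c n

theorem pow_mul_digitSum (hN : 2 ≤ N) (c : ℕ → A) (n : ℕ) :
    (N : ℝ) ^ n * digitSum N A c = digitPrefix N c n + digitSum N A fun k ↦ c (k + n) := by
  have hN0 : (N : ℝ) ≠ 0 := by positivity
  induction n with
  | zero => simp [digitPrefix]
  | succ n ih =>
    have hshift := digitSum_eq hN fun k ↦ c (k + n)
    simp only [zero_add, ifsMap, add_assoc, Nat.add_comm 1 n] at hshift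
    rw [pow_succ, mul_right_comm, ih, hshift, digitPrefix]
    push_cast
    field_simp
    ring

theorem digitPrefix_congr {c c' : ℕ → A} {n : ℕ} (h : ∀ i < n, c i = c' i) :
    digitPrefix N c n = digitPrefix N c' n := by
  induction n with
  | zero => rfl
  | succ n ih => rw [digitPrefix, digitPrefix, ih fun i hi ↦ h i (by omega), h n (by omega)]

theorem eq_of_digitPrefix_eq (hN : N ≠ 0) (hA : ∀ a ∈ A, ∀ b ∈ A, (N : ℤ) ∣ a - b → a = b)
    {c c' : ℕ → A} {n : ℕ} (h : digitPrefix N c n = digitPrefix N c' n) {i : ℕ} (hi : i < n) :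
    c i = c' i := by
  induction n with
  | zero => omega
  | succ n ih =>
    rw [digitPrefix, digitPrefix] at h
    have hlast : c n = c' n := Subtype.ext <| hA _ (c n).2 _ (c' n).2
      ⟨digitPrefix N c' n - digitPrefix N c n, by linear_combination h⟩
    rw [hlast, add_left_inj, mul_right_inj' (Int.natCast_ne_zero.2 hN)] at h
    obtain hi | rfl := Nat.lt_succ_iff_lt_or_eq.1 hi
    · exact ih h hi
    · exact hlast

theorem exists_abs_digitSum_le (hN : 2 ≤ N) (hne : A.Nonempty) :
    ∃ R : ℕ, ∀ c, |digitSum N A c| ≤ R := by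
  obtain ⟨R, hR⟩ := (selfSimilarSet_spec hN hne).2.1.isBounded.exists_norm_le
  obtain ⟨R', hR'⟩ := exists_nat_ge R
  exact ⟨R', fun c ↦ (hR _ ⟨c, rfl⟩).trans hR'⟩

theorem card_le_of_abs_sub_le {S : Finset ℝ} {q r : ℕ} (hq : q ≠ 0)
    (hqS : ∀ y ∈ S, ∃ a : ℤ, (q : ℝ) * y = a) (hS : ∀ x ∈ S, ∀ y ∈ S, q * |x - y| ≤ r) :
    S.card ≤ 2 * r + 1 := by
  obtain rfl | ⟨x, hx⟩ := S.eq_empty_or_nonempty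
  · exact Nat.zero_le _
  choose! a ha using hqS
  have hmaps : Set.MapsTo a S (Finset.Icc (a x - r) (a x + r)) := fun y hy ↦ by
    have hdist : |(a y - a x : ℝ)| ≤ r := by
      rw [← ha y hy, ← ha x hx, ← mul_sub, abs_mul, Nat.abs_cast]
      exact hS y hy x hx
    have hdist' : |a y - a x| ≤ r := by exact_mod_cast hdist
    rw [Finset.coe_Icc, Set.mem_Icc]
    constructor <;> linarith [abs_le.1 hdist']
  have hinj : Set.InjOn a S := fun y hy z hz hyz ↦
    mul_left_cancel₀ (Nat.cast_ne_zero.2 hq : (q : ℝ) ≠ 0) (by rw [ha y hy, ha z hz, hyz])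
  refine (Finset.card_le_card_of_injOn a hmaps hinj).trans_eq ?_
  rw [Int.card_Icc]
  omega

theorem card_le_of_subset_selfSimilarSet (hN : 2 ≤ N) {R : ℕ} (hR : ∀ c, |digitSum N A c| ≤ R)
    {q n : ℕ} (hq0 : q ≠ 0) (hq : q ≤ N ^ n) {S : Finset ℝ} (hS : ↑S ⊆ selfSimilarSet N A)
    (hqS : ∀ y ∈ S, ∃ a : ℤ, (q : ℝ) * y = a) : S.card ≤ (4 * R + 1) * A.card ^ n := by
  classical
  obtain rfl | ⟨y, hy⟩ := S.eq_empty_or_nonempty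
  · exact Nat.zero_le _
  have : Nonempty (ℕ → A) := ⟨(hS hy).choose⟩
  have hcode : ∀ y ∈ S, ∃ c, digitSum N A c = y := fun y hy ↦ hS hy
  choose! c hc using hcode
  have hexpand : ∀ y ∈ S, (N : ℝ) ^ n * y =
      digitPrefix N (c y) n + digitSum N A fun k ↦ c y (k + n) := fun y hy ↦ by
    rw [← pow_mul_digitSum hN, hc y hy]
  have hcard := Finset.card_le_mul_card_image_of_maps_to (s := S)
    (t := (Finset.univ : Finset (Fin n → A))) (f := fun y (i : Fin n) ↦ c y i)
    (fun _ _ ↦ Finset.mem_univ _) (4 * R + 1) fun u _ ↦ ?_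
  · simpa using hcard
  rw [show 4 * R + 1 = 2 * (2 * R) + 1 by ring]
  refine card_le_of_abs_sub_le hq0 (fun y hy ↦ hqS y (Finset.mem_filter.1 hy).1)
    fun x hx y hy ↦ ?_
  rw [Finset.mem_filter] at hx hy
  have hdigits : digitPrefix N (c x) n = digitPrefix N (c y) n :=
    digitPrefix_congr fun i hi ↦ congrFun (hx.2.trans hy.2.symm) ⟨i, hi⟩
  calc (q : ℝ) * |x - y| ≤ (N : ℝ) ^ n * |x - y| := by gcongr; exact_mod_cast hq
    _ = |(digitSum N A fun k ↦ c x (k + n)) - digitSum N A fun k ↦ c y (k + n)| := by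
      rw [← abs_of_nonneg (by positivity : (0 : ℝ) ≤ (N : ℝ) ^ n), ← abs_mul, mul_sub,
        hexpand x hx.1, hexpand y hy.1, hdigits, add_sub_add_left_eq_sub]
    _ ≤ (2 * R : ℕ) := by
      push_cast
      exact (abs_sub _ _).trans (by linarith [hR fun k ↦ c x (k + n), hR fun k ↦ c y (k + n)])

theorem pow_rpow_logb {b a : ℝ} (hb : 1 < b) (ha : 0 < a) (n : ℕ) :
    (b ^ n) ^ Real.logb b a = a ^ n := by
  rw [← Real.rpow_natCast_mul (by positivity), mul_comm, Real.rpow_mul_natCast (by positivity),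
    Real.rpow_logb (by positivity) hb.ne' ha]

theorem exists_card_le_mul_rpow (hN : 2 ≤ N) (hne : A.Nonempty) :
    ∃ M : ℝ, ∀ q : ℕ, q ≠ 0 → ∀ S : Finset ℝ, ↑S ⊆ selfSimilarSet N A →
      (∀ y ∈ S, ∃ a : ℤ, (q : ℝ) * y = a) → (S.card : ℝ) ≤ M * (q : ℝ) ^ Real.logb N A.card := by
  have hN1 : (1 : ℝ) < N := by exact_mod_cast hN
  have hA1 : (1 : ℝ) ≤ A.card := by exact_mod_cast hne.card_pos
  obtain ⟨R, hR⟩ := exists_abs_digitSum_le hN hne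
  refine ⟨(4 * R + 1) * A.card, fun q hq S hS hqS ↦ ?_⟩
  obtain ⟨n, hn, hn'⟩ := exists_nat_pow_near
    (by exact_mod_cast Nat.one_le_iff_ne_zero.2 hq : (1 : ℝ) ≤ q) hN1
  have hcard := card_le_of_subset_selfSimilarSet hN hR hq (by exact_mod_cast hn'.le) hS hqS
  calc (S.card : ℝ) ≤ (4 * R + 1) * (A.card : ℝ) ^ (n + 1) := by exact_mod_cast hcard
    _ = (4 * R + 1) * A.card * ((N : ℝ) ^ n) ^ Real.logb N A.card := by
      rw [pow_rpow_logb hN1 (by positivity), pow_succ', mul_assoc]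
    _ ≤ _ := by
      gcongr
      exact Real.logb_nonneg hN1 hA1

theorem infinitePi_digitPrefix_le (hN : N ≠ 0) (hne : A.Nonempty)
    (hA : ∀ a ∈ A, ∀ b ∈ A, (N : ℤ) ∣ a - b → a = b) (n : ℕ) (z : ℤ) :
    (Measure.infinitePi fun _ : ℕ ↦ uniformOn (Set.univ : Set A)) {c | digitPrefix N c n = z} ≤
      (A.card : ENNReal)⁻¹ ^ n := by
  have := isProbabilityMeasure_uniform_digits hne
  obtain h | ⟨c₀, hc₀⟩ := {c : ℕ → A | digitPrefix N c n = z}.eq_empty_or_nonempty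
  · simp only [h, measure_empty, zero_le]
  calc _ ≤ (Measure.infinitePi fun _ : ℕ ↦ uniformOn (Set.univ : Set A))
        (Set.pi (Finset.range n) fun i ↦ {c₀ i}) := measure_mono fun c hc i hi ↦
          eq_of_digitPrefix_eq hN hA (hc.trans hc₀.symm) (Finset.mem_range.1 hi)
    _ = (A.card : ENNReal)⁻¹ ^ n := by
      rw [Measure.infinitePi_pi _ fun i _ ↦ measurableSet_singleton _]
      simp [uniformOn_univ]

theorem selfSimilarMeasure_closedBall_pow_le (hN : 2 ≤ N) (hne : A.Nonempty)
    (hA : ∀ a ∈ A, ∀ b ∈ A, (N : ℤ) ∣ a - b → a = b) {R : ℕ} (hR : ∀ c, |digitSum N A c| ≤ R)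
    (x : ℝ) (n : ℕ) :
    selfSimilarMeasure N A (Metric.closedBall x ((N : ℝ) ^ n)⁻¹) ≤
      (2 * R + 3 : ℕ) * (A.card : ENNReal)⁻¹ ^ n := by
  have hNp : (0 : ℝ) < (N : ℝ) ^ n := by positivity
  rw [selfSimilarMeasure, Measure.map_apply (continuous_digitSum hN A).measurable
    measurableSet_closedBall]
  set u := (N : ℝ) ^ n * x
  have hsub : digitSum N A ⁻¹' Metric.closedBall x ((N : ℝ) ^ n)⁻¹ ⊆
      ⋃ z ∈ Finset.Icc ⌈u - (R + 1)⌉ ⌊u + (R + 1)⌋, {c | digitPrefix N c n = z} := by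
    intro c hc
    have hscale : |(N : ℝ) ^ n * digitSum N A c - u| ≤ 1 := by
      rw [← mul_sub, abs_mul, abs_of_pos hNp, ← le_div_iff₀' hNp, one_div]
      exact hc
    rw [pow_mul_digitSum hN, abs_le] at hscale
    have htail := abs_le.1 (hR fun k ↦ c (k + n))
    simp only [Set.mem_iUnion₂, Finset.mem_Icc, Int.ceil_le, Int.le_floor]
    exact ⟨_, ⟨by linarith, by linarith⟩, rfl⟩
  have hcard : (Finset.Icc ⌈u - (R + 1)⌉ ⌊u + (R + 1)⌋).card ≤ 2 * R + 3 := by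
    have hlen : (⌊u + (R + 1)⌋ : ℝ) - ⌈u - (R + 1)⌉ ≤ 2 * R + 2 := by
      linarith [Int.floor_le (u + (R + 1)), Int.le_ceil (u - (R + 1))]
    have hlen' : ⌊u + (R + 1)⌋ - ⌈u - (R + 1)⌉ ≤ 2 * R + 2 := by exact_mod_cast hlen
    rw [Int.card_Icc]
    omega
  calc _ ≤ _ := (measure_mono hsub).trans (measure_biUnion_finset_le _ _)
    _ ≤ _ := Finset.sum_le_card_nsmul _ _ _ fun z _ ↦
      infinitePi_digitPrefix_le (by omega) hne hA n z
    _ ≤ _ := by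
      rw [nsmul_eq_mul]
      gcongr

theorem selfSimilarMeasure_closedBall_le (hN : 2 ≤ N) (hne : A.Nonempty)
    (hA : ∀ a ∈ A, ∀ b ∈ A, (N : ℤ) ∣ a - b → a = b) {R : ℕ} (hR : ∀ c, |digitSum N A c| ≤ R)
    (x : ℝ) {r : ℝ} (hr : r ∈ Set.Ioo (0 : ℝ) 1) :
    selfSimilarMeasure N A (Metric.closedBall x r) ≤
      (2 * R + 3 : ℕ) * A.card * ENNReal.ofReal r ^ Real.logb N A.card := by
  have hN1 : (1 : ℝ) < N := by exact_mod_cast hN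
  have hA1 : (1 : ℝ) ≤ A.card := by exact_mod_cast hne.card_pos
  have hs : 0 ≤ Real.logb N A.card := Real.logb_nonneg hN1 hA1
  obtain ⟨n, hn, hn'⟩ := exists_nat_pow_near ((one_le_inv₀ hr.1).2 hr.2.le) hN1
  have hpow : ((A.card : ℝ) ^ n)⁻¹ ≤ A.card * r ^ Real.logb N A.card := by
    calc ((A.card : ℝ) ^ n)⁻¹ = A.card * ((A.card : ℝ) ^ (n + 1))⁻¹ := by
          rw [pow_succ]
          field_simp
      _ = A.card * ((N : ℝ) ^ (n + 1))⁻¹ ^ Real.logb N A.card := by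
          rw [Real.inv_rpow (by positivity), pow_rpow_logb hN1 (by positivity)]
      _ ≤ A.card * r ^ Real.logb N A.card := by
          gcongr
          exact inv_le_of_inv_le₀ hr.1 hn'.le
  calc _ ≤ selfSimilarMeasure N A (Metric.closedBall x ((N : ℝ) ^ n)⁻¹) :=
        measure_mono (Metric.closedBall_subset_closedBall
          ((le_inv_comm₀ hr.1 (by positivity)).2 hn))
    _ ≤ _ := selfSimilarMeasure_closedBall_pow_le hN hne hA hR x n
    _ ≤ _ := by
      rw [mul_assoc, ← ENNReal.inv_pow, ENNReal.ofReal_rpow_of_pos hr.1]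
      gcongr
      have := ENNReal.ofReal_le_ofReal hpow
      rwa [ENNReal.ofReal_inv_of_pos (by positivity), ENNReal.ofReal_pow (by positivity),
        ENNReal.ofReal_mul (by positivity), ENNReal.ofReal_natCast] at this

theorem selfSimilarMeasure_selfSimilarSet (hN : 2 ≤ N) (hne : A.Nonempty) :
    selfSimilarMeasure N A (selfSimilarSet N A) = 1 := by
  have := isProbabilityMeasure_uniform_digits hne
  rw [selfSimilarMeasure, Measure.map_apply (continuous_digitSum hN A).measurable
    (selfSimilarSet_spec hN hne).2.1.isClosed.measurableSet, selfSimilarSet, Set.preimage_range,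
    measure_univ]

theorem logb_card_le_dimH (hN : 2 ≤ N) (hne : A.Nonempty)
    (hA : ∀ a ∈ A, ∀ b ∈ A, (N : ℤ) ∣ a - b → a = b) :
    ENNReal.ofReal (Real.logb N A.card) ≤ dimH (selfSimilarSet N A) := by
  obtain ⟨R, hR⟩ := exists_abs_digitSum_le hN hne
  have hs : 0 ≤ Real.logb N A.card :=
    Real.logb_nonneg (by exact_mod_cast hN) (by exact_mod_cast hne.card_pos)
  refine le_dimH_of_measure_closedBall_le (μ := selfSimilarMeasure N A)
    (M := (2 * R + 3 : ℕ) * A.card) (by finiteness) (fun x r hr ↦ ?_)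
    (selfSimilarMeasure_selfSimilarSet hN hne ▸ one_ne_zero)
  rw [Real.coe_toNNReal _ hs]
  exact selfSimilarMeasure_closedBall_le hN hne hA hR x hr

theorem eventually_ncard_le_rpow (hN : 2 ≤ N) (hne : A.Nonempty)
    (hA : ∀ a ∈ A, ∀ b ∈ A, (N : ℤ) ∣ a - b → a = b) {δ : ℝ}
    (hδ : dimH (selfSimilarSet N A) < ENNReal.ofReal δ) {d : ℕ} (hd : d ≠ 0) :
    ∀ᶠ p : ℕ in atTop, ∀ B : Finset ℤ, B.gcd Int.natAbs = d → ∀ C : Set ℝ, C.Finite →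
      C ⊆ selfSimilarSet N A → ((p : ℝ) * ·) '' C ⊆ dualLattice B →
        (C.ncard : ℝ) ≤ (p : ℝ) ^ δ := by
  obtain ⟨M, hM⟩ := exists_card_le_mul_rpow hN hne
  set s := Real.logb N A.card
  have hs : 0 ≤ s := Real.logb_nonneg (by exact_mod_cast hN) (by exact_mod_cast hne.card_pos)
  have hlt : s < δ := (ENNReal.ofReal_lt_ofReal_iff_of_nonneg hs).1
    ((logb_card_le_dimH hN hne hA).trans_lt hδ)
  have hgrowth := ((tendsto_rpow_atTop (sub_pos.2 hlt)).comp
    tendsto_natCast_atTop_atTop).eventually_ge_atTop (M * (d : ℝ) ^ s)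
  filter_upwards [hgrowth, eventually_gt_atTop 0] with p hp hp0 B hB C hfin hC hpC
  lift C to Finset ℝ using hfin
  have hp0' : (0 : ℝ) < p := Nat.cast_pos.2 hp0
  have hqS : ∀ y ∈ C, ∃ a : ℤ, ((p * d : ℕ) : ℝ) * y = a := fun y hy ↦ by
    obtain ⟨a, ha⟩ := exists_gcd_mul_eq_of_mem_dualLattice (hpC ⟨y, hy, rfl⟩)
    exact ⟨a, by rw [← ha, hB, Nat.cast_mul, mul_assoc, mul_left_comm]⟩
  rw [Set.ncard_coe_finset]
  calc (C.card : ℝ) ≤ M * ((p * d : ℕ) : ℝ) ^ s := hM _ (mul_ne_zero hp0.ne' hd) C hC hqS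
    _ = M * (d : ℝ) ^ s * (p : ℝ) ^ s := by
      rw [Nat.cast_mul, Real.mul_rpow hp0'.le (Nat.cast_nonneg d)]
      ring
    _ ≤ (p : ℝ) ^ (δ - s) * (p : ℝ) ^ s := by gcongr; exact hp
    _ = (p : ℝ) ^ δ := by rw [← Real.rpow_add hp0', sub_add_cancel]

end Digits

section SpectralEigenvalue

variable {N : ℕ} {B L : Finset ℤ}

theorem IsHadamardTriple.isSpectralEigenvalue (h : IsHadamardTriple N B L) (hB : 0 ∈ B)
    (hL : 0 ∈ L) {p : ℕ} (hp : p.Prime) (hpN : ¬ p ∣ N)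
    (hC : ∀ C, IsCycle N L C → ((p : ℝ) * ·) '' C ⊆ dualLattice B →
      C.ncard < orderOf (N : ZMod p)) :
    IsSpectralEigenvalue (selfSimilarMeasure N B) (canonicalSpectrum N B L) p := by
  refine ⟨h.isSpectralPair hB hL, ?_⟩
  have hscale := canonicalSpectrum_image_mul (N := N) (L := L)
    (Int.natCast_ne_zero.2 hp.ne_zero) hB fun C hcyc hpC ↦ by
      by_contra hnot
      exact (hC C hcyc hpC).not_ge <| orderOf_le_ncard (by linarith [h.two_le]) hp
        hcyc.finite hcyc.subset_iUnion_image hpC hnot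
  simp only [Int.cast_natCast] at hscale
  rw [← hscale]
  exact (h.image_mul ((Nat.Prime.coprime_iff_not_dvd hp).2 hpN)).isSpectralPair hB
    (Finset.mem_image.2 ⟨0, hL, mul_zero _⟩)

theorem IsHadamardTriple.gcd_ne_zero (h : IsHadamardTriple N B L) : B.gcd Int.natAbs ≠ 0 := by
  obtain ⟨b, hb, hb0⟩ := h.exists_mem_ne_zero
  exact fun h0 ↦ hb0 (Int.natAbs_eq_zero.1 (Finset.gcd_eq_zero_iff.1 h0 b hb))

end SpectralEigenvalue

theorem proposition3p3_general (K : Set ℝ) (δ : ℝ) (d : ℕ) (hKδ : dimH K < ENNReal.ofReal δ) :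
    ∃ p₀ : ℝ, 0 < p₀ ∧ ∀ (N : ℕ) (B L : Finset ℤ), IsHadamardTriple N B L → 0 ∈ B → 0 ∈ L →
      selfSimilarSet N L = K → B.gcd Int.natAbs = d → ∀ p ∈ largeOrderPrimes N δ, p₀ ≤ (p : ℝ) →
        IsSpectralEigenvalue (selfSimilarMeasure N B) (canonicalSpectrum N B L) (p : ℝ) := by
  by_cases hex : ∃ (N : ℕ) (B L : Finset ℤ), IsHadamardTriple N B L ∧ 0 ∈ L ∧
      selfSimilarSet N L = K ∧ B.gcd Int.natAbs = d
  swap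
  · exact ⟨1, one_pos, fun N B L h _ hL hK hd ↦ (hex ⟨N, B, L, h, hL, hK, hd⟩).elim⟩
  obtain ⟨N₀, B₀, L₀, h₀, hL₀, rfl, rfl⟩ := hex
  obtain ⟨p₀, hcard⟩ := eventually_atTop.1 <| eventually_ncard_le_rpow h₀.two_le ⟨0, hL₀⟩
    (fun _ ha _ hb ↦ h₀.eq_of_dvd_sub ha hb) hKδ h₀.gcd_ne_zero
  refine ⟨p₀ + 1, by positivity, fun N B L h hB hL hK hd p ⟨hp, hpN, hord⟩ hpp ↦ ?_⟩
  refine h.isSpectralEigenvalue hB hL hp hpN fun C hC hpC ↦ ?_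
  have hp₀ : p₀ ≤ p := by exact_mod_cast (le_add_of_nonneg_right zero_le_one).trans hpp
  have hCK : C ⊆ selfSimilarSet N₀ L₀ :=
    hK ▸ subset_selfSimilarSet h.two_le hC.finite.isBounded hC.subset_iUnion_image
  exact_mod_cast (hcard p hp₀ B hd C hC.finite hCK hpC).trans_lt hord

/-- `p₀` depends only on `K = K(N, L)`, `δ` and `d = gcd(B)`. -/
theorem proposition3p3 (K : Set ℝ) (δ : ℝ) (d : ℕ)
    (hKδ : dimH K < ENNReal.ofReal δ) (hδ : δ < 1) :
    ∃ p₀ : ℝ, 0 < p₀ ∧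
      ∀ (N : ℕ) (B L : Finset ℤ), IsHadamardTriple N B L → 0 ∈ B → 0 ∈ L → B.card < N →
        selfSimilarSet N L = K → B.gcd Int.natAbs = d → (largeOrderPrimes N δ).Infinite →
          ∀ p ∈ largeOrderPrimes N δ, p₀ ≤ (p : ℝ) →
            IsSpectralEigenvalue (selfSimilarMeasure N B) (canonicalSpectrum N B L) (p : ℝ) := by
  obtain ⟨p₀, hp₀, h⟩ := proposition3p3_general K δ d hKδ
  exact ⟨p₀, hp₀, fun N B L hH hB hL _ hK hd _ ↦ h N B L hH hB hL hK hd⟩
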